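/- Let $X$ be a real ordered Banach space whose (closed) positive cone $X_+$ is generating, $X=X_+-X_+$, and whose norm is additive on $X_+$; let $\Psi\in X^\star$ be the unique continuous linear functional with $\langle\Psi,u\rangle=\|u\|$ for $u\in X_+$. A $C_0$-semigroup $(T(t))_{t\ge 0}$ on $X$ is called substochastic if $T(t)u\in X_+$ and $\|T(t)u\|\le\|u\|$ for all $u\in X_+$, $t\ge 0$. Let $A$ be the generator of a substochastic $C_0$-semigroup on $X$ and let $B:D(A)\to X$ be linear with $Bu\in X_+$ and $\langle\Psi,Au+Bu\rangle\le 0$ for all $u\in D(A)\cap X_+$. Then there is a unique smallest substochastic $C_0$-semigroup $(V(t))_{t\ge0}$ whose generator extends $(A+B,D(A))$ (smallest: $V(t)u\le S(t)u$ for all $t\ge 0$, $u\in X_+$ and every substochastic $C_0$-semigroup $S$ whose generator extends $A+B$). Let $G$ be its generator. The operator $A+B$ is closable, and every $\lambda>0$ belongs to the resolvent sets of $A$ and of $G$. Put $\mathfrak a_0(v)=-\langle\Psi,Gv\rangle$ for $v\in D(G)$ and $\mathfrak a(w)=-\langle\Psi,Aw+Bw\rangle$ for $w\in D(A)$. For $\lambda>0$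 and $u\in X$ the series $$\overline{\mathfrak a}\big((\lambda-G)^{-1}u\big)=\sum_{n=0}^\infty\mathfrak a\big((\lambda-A)^{-1}[B(\lambda-A)^{-1}]^nu\big)$$ converges absolutely, the functional $\overline{\mathfrak a}$ on $D(G)$ defined in this way does not depend on $\lambda$, and $$\langle\Xi_\lambda,u\rangle=\mathfrak a_0\big((\lambda-G)^{-1}u\big)-\overline{\mathfrak a}\big((\lambda-G)^{-1}u\big),\qquad u\in X,$$ defines $\Xi_\lambda\in X^\star$. **Theorem.** For every $\lambda>0$ and $u\in X_+$ the following are equivalent: (i) the set $\{[B(\lambda-A)^{-1}]^nu : n\in\mathbb N\}$ is relatively weakly compact; (ii) $\lim_{n\to\infty}\|[B(\lambda-A)^{-1}]^nu\|=0$; (iii) $\langle\Xi_\lambda,u\rangle=0$; (iv) $(\lambda-G)^{-1}u\in D(\overline{A+B})$. **Corollary.** The following are equivalent: $G=\overline{A+B}$; $\Xi_\lambda=0$ for some $\lambda>0$; $\Xi_\lambda=0$ for all $\lambda>0$. -/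

import Mathlib

open Filter Topology
open scoped NNReal

namespace Honesty

/-! ### Abstract state spaces -/

/-- The two properties that make an ordered Banach space with closed positive cone an abstract
state space: the positive cone is generating, and the norm is additive on it. -/
class AbstractStateSpace (X : Type*) [NormedAddCommGroup X] [PartialOrder X] : Prop where
  generating : ∀ u : X, ∃ a b : X, 0 ≤ a ∧ 0 ≤ b ∧ u = a - b
  norm_add : ∀ u v : X, 0 ≤ u → 0 ≤ v → ‖u + v‖ = ‖u‖ + ‖v‖

/-- The number `‖a‖ - ‖b‖` for a decomposition `u = a - b` of `u` into positive elements. -/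
noncomputable def psiFun {X : Type*} [NormedAddCommGroup X] [PartialOrder X]
    [AbstractStateSpace X] (u : X) : ℝ :=
  ‖(AbstractStateSpace.generating u).choose‖ -
    ‖(AbstractStateSpace.generating u).choose_spec.choose‖

/-- `psiFun` does not depend on the decomposition. -/
theorem psiFun_sub {X : Type*} [NormedAddCommGroup X] [PartialOrder X] [AbstractStateSpace X]
    (a b : X) (ha : 0 ≤ a) (hb : 0 ≤ b) : psiFun (a - b) = ‖a‖ - ‖b‖ := by
  obtain ⟨hc, hd, h⟩ := (AbstractStateSpace.generating (a - b)).choose_spec.choose_spec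
  unfold psiFun
  set c := (AbstractStateSpace.generating (a - b)).choose
  set d := (AbstractStateSpace.generating (a - b)).choose_spec.choose
  have h1 : a + d = c + b := by
    rw [sub_eq_sub_iff_add_eq_add] at h
    exact h
  have h2 := AbstractStateSpace.norm_add a d ha hd
  have h3 := AbstractStateSpace.norm_add c b hc hb
  rw [h1, h3] at h2
  linarith

/-- The functional `Ψ`: the unique continuous linear functional that coincides with the norm on
the positive cone. -/
noncomputable def Psi (X : Type*) [NormedAddCommGroup X] [NormedSpace ℝ X] [PartialOrder X]
    [IsOrderedAddMonoid X] [AbstractStateSpace X] : X →L[ℝ] ℝ :=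
  AddMonoidHom.toRealLinearMap
    (AddMonoidHom.mk' (psiFun : X → ℝ) (by
      intro u v
      obtain ⟨a, b, ha, hb, rfl⟩ := AbstractStateSpace.generating u
      obtain ⟨c, d, hc, hd, rfl⟩ := AbstractStateSpace.generating v
      rw [show a - b + (c - d) = (a + c) - (b + d) by abel,
        psiFun_sub _ _ (add_nonneg ha hc) (add_nonneg hb hd), psiFun_sub _ _ ha hb,
        psiFun_sub _ _ hc hd, AbstractStateSpace.norm_add _ _ ha hc,
        AbstractStateSpace.norm_add _ _ hb hd]
      ring))
    (AddMonoidHomClass.continuous_of_bound _ 1 (by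
      intro u
      obtain ⟨a, b, ha, hb, rfl⟩ := AbstractStateSpace.generating u
      rw [AddMonoidHom.mk'_apply, psiFun_sub _ _ ha hb, one_mul, Real.norm_eq_abs]
      exact abs_norm_sub_norm_le a b))

/-- `Ψ` coincides with the norm on the positive cone. -/
theorem Psi_of_nonneg {X : Type*} [NormedAddCommGroup X] [NormedSpace ℝ X] [PartialOrder X]
    [IsOrderedAddMonoid X] [AbstractStateSpace X] (u : X) (hu : 0 ≤ u) : Psi X u = ‖u‖ := by
  have h := psiFun_sub u 0 hu le_rfl
  rw [sub_zero, norm_zero, sub_zero] at h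
  exact h

/-! ### Strongly continuous semigroups and their generators -/

/-- Strongly continuous one-parameter semigroups of bounded linear operators. -/
@[ext]
structure C0Semigroup (X : Type*) [NormedAddCommGroup X] [NormedSpace ℝ X] where
  op : ℝ≥0 → X →L[ℝ] X
  op_zero : op 0 = ContinuousLinearMap.id ℝ X
  op_add : ∀ s t : ℝ≥0, op (s + t) = (op s).comp (op t)
  tendsto_zero : ∀ x : X, Tendsto (fun t : ℝ≥0 => op t x) (𝓝 0) (𝓝 x)

namespace C0Semigroup

/-- The graph of the generator: the pairs `(x, y)` such that `(T(t)x - x) / t → y` as `t → 0+`. -/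
noncomputable def generatorGraph {X : Type*} [NormedAddCommGroup X] [NormedSpace ℝ X]
    (T : C0Semigroup X) : Submodule ℝ (X × X) where
  carrier := {p | Tendsto (fun t : ℝ≥0 => (t : ℝ)⁻¹ • (T.op t p.1 - p.1)) (𝓝[>] 0) (𝓝 p.2)}
  add_mem' := by
    intro p q hp hq
    refine (Tendsto.add hp hq).congr fun t => ?_
    rw [Prod.fst_add, map_add, ← smul_add]
    congr 1
    abel
  zero_mem' := by simp
  smul_mem' := by
    intro c p hp
    refine (Tendsto.const_smul hp c).congr fun t => ?_
    rw [Prod.smul_fst, map_smul, ← smul_sub, smul_comm]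

/-- The generator of a strongly continuous semigroup, as an unbounded operator. -/
noncomputable def generator {X : Type*} [NormedAddCommGroup X] [NormedSpace ℝ X]
    (T : C0Semigroup X) : X →ₗ.[ℝ] X :=
  T.generatorGraph.toLinearPMap

/-- The graph of the generator is what it should be. -/
theorem mem_graph_generator {X : Type*} [NormedAddCommGroup X] [NormedSpace ℝ X]
    (T : C0Semigroup X) (x y : X) : (x, y) ∈ T.generator.graph ↔
      Tendsto (fun t : ℝ≥0 => (t : ℝ)⁻¹ • (T.op t x - x)) (𝓝[>] 0) (𝓝 y) := by
  unfold generator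
  rw [Submodule.toLinearPMap_graph_eq]
  · rfl
  · rintro ⟨a, b⟩ h h0
    have h0' : a = 0 := h0
    subst h0'
    have h1 : Tendsto (fun t : ℝ≥0 => (t : ℝ)⁻¹ • (T.op t (0 : X) - 0)) (𝓝[>] 0) (𝓝 b) := h
    simp only [map_zero, sub_zero, smul_zero] at h1
    exact tendsto_nhds_unique h1 tendsto_const_nhds

/-- Substochastic semigroups: positive, and contractive on the positive cone. -/
def IsSubstochastic {X : Type*} [NormedAddCommGroup X] [NormedSpace ℝ X] [PartialOrder X]
    (T : C0Semigroup X) : Prop :=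
  ∀ t : ℝ≥0, ∀ u : X, 0 ≤ u → 0 ≤ T.op t u ∧ ‖T.op t u‖ ≤ ‖u‖

end C0Semigroup

/-! ### Resolvents of unbounded operators -/

/-- The operator `lam - A`, defined on the domain of `A`. -/
def shift {X : Type*} [NormedAddCommGroup X] [NormedSpace ℝ X] (A : X →ₗ.[ℝ] X) (lam : ℝ) :
    A.domain →ₗ[ℝ] X :=
  lam • A.domain.subtype - A.toFun

/-- The real resolvent set of `A`: the `lam` such that `lam - A` is a bijection from the domain of
`A` onto the space, with bounded inverse. -/
def realResolventSet {X : Type*} [NormedAddCommGroup X] [NormedSpace ℝ X] (A : X →ₗ.[ℝ] X) : Set ℝ :=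
  {lam | Function.Bijective (shift A lam) ∧ ∃ C : ℝ, ∀ u : A.domain, ‖(u : X)‖ ≤ C * ‖shift A lam u‖}

open Classical in
/-- The resolvent `(lam - A)⁻¹`, as a map onto the domain of `A` (and `0`, by convention, if `lam - A`
is not bijective). -/
noncomputable def invShift {X : Type*} [NormedAddCommGroup X] [NormedSpace ℝ X]
    (A : X →ₗ.[ℝ] X) (lam : ℝ) : X →ₗ[ℝ] A.domain :=
  if h : Function.Bijective (shift A lam) then
    ((LinearEquiv.ofBijective (shift A lam) h).symm : X →ₗ[ℝ] A.domain)
  else 0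

/-! ### The perturbed operator and its functionals -/

/-- The operator `A + B` with domain the domain of `A`, where `B` is defined on the domain
of `A`. -/
def perturbed {X : Type*} [NormedAddCommGroup X] [NormedSpace ℝ X] (A : X →ₗ.[ℝ] X)
    (B : A.domain →ₗ[ℝ] X) : X →ₗ.[ℝ] X where
  domain := A.domain
  toFun := A.toFun + B

/-- `V` is the smallest substochastic semigroup whose generator extends `A + B`. -/
structure IsMinimalSemigroup {X : Type*} [NormedAddCommGroup X] [NormedSpace ℝ X] [PartialOrder X]
    (A : X →ₗ.[ℝ] X) (B : A.domain →ₗ[ℝ] X) (V : C0Semigroup X) : Prop where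
  substochastic : V.IsSubstochastic
  extends_perturbed : perturbed A B ≤ V.generator
  minimal : ∀ S : C0Semigroup X, S.IsSubstochastic → perturbed A B ≤ S.generator →
    ∀ t : ℝ≥0, ∀ u : X, 0 ≤ u → V.op t u ≤ S.op t u

/-- The operator `B (lam - A)⁻¹` on the whole space. -/
noncomputable def iterOp {X : Type*} [NormedAddCommGroup X] [NormedSpace ℝ X]
    (A : X →ₗ.[ℝ] X) (B : A.domain →ₗ[ℝ] X) (lam : ℝ) : X →ₗ[ℝ] X :=
  B ∘ₗ invShift A lam

/-- For an unbounded operator `T`, the functional `v ↦ -⟨Ψ, T v⟩` on the domain of `T`. For the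
generator `G` this is `𝔞₀`, for `A + B` this is `𝔞`. -/
noncomputable def lossFunctional {X : Type*} [NormedAddCommGroup X] [NormedSpace ℝ X]
    [PartialOrder X] [IsOrderedAddMonoid X] [AbstractStateSpace X] (T : X →ₗ.[ℝ] X)
    (v : T.domain) : ℝ :=
  -Psi X (T v)

/-- The terms `𝔞((lam - A)⁻¹ [B (lam - A)⁻¹]ⁿ u)` of the series that defines the value of the
functional `𝔞bar` at `(lam - G)⁻¹ u`. -/
noncomputable def abarTerm {X : Type*} [NormedAddCommGroup X] [NormedSpace ℝ X]
    [PartialOrder X] [IsOrderedAddMonoid X] [AbstractStateSpace X] (A : X →ₗ.[ℝ] X)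
    (B : A.domain →ₗ[ℝ] X) (lam : ℝ) (u : X) (n : ℕ) : ℝ :=
  lossFunctional (perturbed A B) (invShift A lam ((iterOp A B lam ^ n) u))

/-- The functional `𝔞bar` on the domain of `G`, computed with the parameter `lam`: its value at
`v = (lam - G)⁻¹ u`, that is for `u = (lam - G) v`, is the sum of the series above. -/
noncomputable def abar {X : Type*} [NormedAddCommGroup X] [NormedSpace ℝ X]
    [PartialOrder X] [IsOrderedAddMonoid X] [AbstractStateSpace X] (A : X →ₗ.[ℝ] X)
    (B : A.domain →ₗ[ℝ] X) (G : X →ₗ.[ℝ] X) (lam : ℝ) (v : G.domain) : ℝ :=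
  ∑' n : ℕ, abarTerm A B lam (shift G lam v) n

/-- The value `⟨Ξ_lam, u⟩ = 𝔞₀((lam - G)⁻¹ u) - 𝔞bar((lam - G)⁻¹ u)`. -/
noncomputable def Xi {X : Type*} [NormedAddCommGroup X] [NormedSpace ℝ X]
    [PartialOrder X] [IsOrderedAddMonoid X] [AbstractStateSpace X] (A : X →ₗ.[ℝ] X)
    (B : A.domain →ₗ[ℝ] X) (G : X →ₗ.[ℝ] X) (lam : ℝ) (u : X) : ℝ :=
  lossFunctional G (invShift G lam u) - abar A B G lam (invShift G lam u)

/-- Relative weak compactness: the closure in the weak topology is compact. -/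
def IsRelativelyWeaklyCompact {X : Type*} [NormedAddCommGroup X] [NormedSpace ℝ X]
    (s : Set X) : Prop :=
  IsCompact (closure (toWeakSpace ℝ X '' s))

end Honesty

/-!
Write `R = (lam - A)⁻¹`, `K = B (lam - A)⁻¹`. For `u ≥ 0` the hypothesis `⟨Ψ, (A + B) R u⟩ ≤ 0` reads
`‖K u‖ + lam ‖R u‖ ≤ ‖u‖`. Telescoping it along the iterates `Kⁿ u` shows that `G = ∑ R Kⁿ` converges
absolutely on the cone, with `lam ‖G u‖ ≤ ‖u‖`.

*The minimal semigroup.* The sums `G lam` satisfy the resolvent identity (`IsKatoSum.sum_identity`;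
the remainder `G lam (K mu ^ N x)` vanishes by monotonicity in the parameter) and have dense range, so
a Hille–Yosida theorem (`IsSubstochasticResolvent.exists_semigroup`) produces a substochastic semigroup
with resolvent `G`. If the generator of another substochastic semigroup extends `A + B`, its resolvent
`Q` satisfies `Q (1 - K) = R`, hence dominates all partial sums of `G`; the order of the resolvents
passes to the semigroups through their Yosida approximations (`op_le_op_of_resolvent_le`). All
generation theory rests on one estimate for commuting substochastic semigroups, `norm_op_sub_op_le`.
Boundedness of positive operators comes from a bounded decomposition into positive elements
(`exists_nonneg_sub_norm_le`), an instance of the open mapping theorem.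

*The functional `Ξ`.* The series that defines `𝔞bar` telescopes, and what remains is
`⟨Ξ, u⟩ = lim ⟨Ψ, Kⁿ u⟩`, which is `lim ‖Kⁿ u‖` for `u ≥ 0`; so `⟨Ξ, u⟩ = 0` means that
the iterates tend to zero in norm.
If the iterates are relatively weakly compact, then every weak cluster point `z` of them satisfies
`R z = 0`, because `R Kⁿ u` is the general term of a convergent series; so `z = 0` and `⟨Ξ, u⟩ = ⟨Ψ, z⟩`
vanishes. If the iterates tend to zero, the partial sums of `G u` show that `G u` lies in the domain of
the closure of `A + B`. Conversely `Ξ` is continuous and vanishes on the range of `lam - A - B`, as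
`Ξ ∘ K = Ξ`; so it vanishes at `u` if `G u` lies in that domain.

*Independence of the parameter.* In terms of `Ξ` the claim is
`Ξ_mu (u + (mu - lam) G_lam u) = Ξ_lam u`. For `lam ≤ mu` the left-hand side is invariant under
`K lam`, hence equal to `lim Ξ_mu (K lam ^ n u)`. This is at most `Ξ_lam u` since `Ξ_mu ≤ Ψ` on the cone,
and at least `Ξ_lam u` since each term of the series of losses decreases with the parameter
(`IsKatoPair.loss_term_le`).
-/

set_option linter.unusedSectionVars false

namespace Honesty

/-! ### Positive operators on abstract state spaces -/

section Cone

variable {X : Type*} [NormedAddCommGroup X] [NormedSpace ℝ X] [PartialOrder X]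
  [IsOrderedAddMonoid X] [AbstractStateSpace X]

theorem norm_le_norm_of_nonneg_of_le {u v : X} (hu : 0 ≤ u) (huv : u ≤ v) : ‖u‖ ≤ ‖v‖ := by
  have h := AbstractStateSpace.norm_add u (v - u) hu (sub_nonneg.2 huv)
  rw [add_sub_cancel] at h
  rw [h]
  exact le_add_of_nonneg_right (norm_nonneg _)

/-- Every element is the difference of two positive elements whose norms it controls. This is the
open mapping theorem for the operator `f ↦ ∑ f s • s` from the space `ℓ¹` over the positive part `S`
of the unit ball; the two sums are those over the positive and the negative part of a preimage. -/
theorem exists_nonneg_sub_norm_le [CompleteSpace X] [IsOrderedModule ℝ X]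
    [OrderClosedTopology X] :
    ∃ C : ℝ, 0 < C ∧ ∀ x : X, ∃ a b : X, 0 ≤ a ∧ 0 ≤ b ∧ x = a - b ∧
      ‖a‖ ≤ C * ‖x‖ ∧ ‖b‖ ≤ C * ‖x‖ := by
  let S := {s : X // 0 ≤ s ∧ ‖s‖ ≤ 1}
  have hsn : ∀ f : lp (fun _ : S => ℝ) 1, Summable fun s : S => ‖f s‖ := fun f => by
    simpa using f.2.summable (by norm_num)
  have hnorm : ∀ f : lp (fun _ : S => ℝ) 1, ‖f‖ = ∑' s : S, ‖f s‖ := fun f => by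
    simpa using lp.norm_eq_tsum_rpow (p := 1) (by norm_num) f
  have hle : ∀ (f : lp (fun _ : S => ℝ) 1) (g : ℝ → ℝ), (∀ r, ‖g r‖ ≤ ‖r‖) → ∀ s : S,
      ‖g (f s) • (s : X)‖ ≤ ‖f s‖ := fun f g hg s => by
    rw [norm_smul]
    calc ‖g (f s)‖ * ‖(s : X)‖ ≤ ‖f s‖ * 1 :=
          mul_le_mul (hg _) s.2.2 (norm_nonneg _) (norm_nonneg _)
      _ = ‖f s‖ := mul_one _
  have hsum : ∀ (f : lp (fun _ : S => ℝ) 1) (g : ℝ → ℝ), (∀ r, ‖g r‖ ≤ ‖r‖) →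
      Summable fun s : S => g (f s) • (s : X) := fun f g hg =>
    Summable.of_norm_bounded (hsn f) (hle f g hg)
  have hbd : ∀ (f : lp (fun _ : S => ℝ) 1) (g : ℝ → ℝ), (∀ r, ‖g r‖ ≤ ‖r‖) →
      ‖∑' s : S, g (f s) • (s : X)‖ ≤ ‖f‖ := fun f g hg => by
    rw [hnorm]
    exact tsum_of_norm_bounded (hsn f).hasSum (hle f g hg)
  let Φl : lp (fun _ : S => ℝ) 1 →ₗ[ℝ] X :=
    { toFun := fun f => ∑' s : S, f s • (s : X)
      map_add' := fun f g => by
        refine Eq.trans (tsum_congr fun s => ?_)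
          ((hsum f id fun _ => le_rfl).tsum_add (hsum g id fun _ => le_rfl))
        exact add_smul (f s) (g s) (s : X)
      map_smul' := fun c f => by
        refine Eq.trans (tsum_congr fun s => ?_)
          ((hsum f id fun _ => le_rfl).tsum_const_smul c)
        exact mul_smul c (f s) (s : X) }
  let Φ : lp (fun _ : S => ℝ) 1 →L[ℝ] X := Φl.mkContinuous 1 fun f => by
    rw [one_mul]; exact hbd f id fun _ => le_rfl
  have hcone : ∀ a : X, 0 ≤ a → ∃ f, Φ f = a := fun a ha => by
    classical
    by_cases h0 : a = 0
    · exact ⟨0, by rw [map_zero, h0]⟩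
    have hpos : 0 < ‖a‖ := norm_pos_iff.2 h0
    let s : S := ⟨‖a‖⁻¹ • a, smul_nonneg (by positivity) ha, by
      rw [norm_smul, norm_inv, norm_norm, inv_mul_cancel₀ hpos.ne']⟩
    refine ⟨lp.single 1 s ‖a‖, ?_⟩
    change ∑' t : S, (lp.single 1 s ‖a‖ : lp (fun _ : S => ℝ) 1) t • (t : X) = a
    rw [tsum_eq_single s]
    · rw [lp.single_apply_self]
      exact smul_inv_smul₀ hpos.ne' a
    · intro t ht
      rw [lp.single_apply_ne _ _ _ ht, zero_smul]
  have hsurj : Function.Surjective Φ := fun x => by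
    obtain ⟨a, b, ha, hb, rfl⟩ := AbstractStateSpace.generating x
    obtain ⟨f, rfl⟩ := hcone a ha
    obtain ⟨g, rfl⟩ := hcone b hb
    exact ⟨f - g, map_sub _ _ _⟩
  obtain ⟨C, hC, hpre⟩ := Φ.exists_preimage_norm_le hsurj
  refine ⟨C, hC, fun x => ?_⟩
  obtain ⟨f, rfl, hf⟩ := hpre x
  have hp : ∀ r : ℝ, ‖max r 0‖ ≤ ‖r‖ := fun r => by
    rw [Real.norm_eq_abs, Real.norm_eq_abs, abs_of_nonneg (le_max_right _ _)]
    exact max_le (le_abs_self r) (abs_nonneg r)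
  have hm : ∀ r : ℝ, ‖max (-r) 0‖ ≤ ‖r‖ := fun r => by simpa using hp (-r)
  refine ⟨∑' s : S, max (f s) 0 • (s : X), ∑' s : S, max (-f s) 0 • (s : X), ?_, ?_, ?_,
    (hbd f (fun r => max r 0) hp).trans hf, (hbd f (fun r => max (-r) 0) hm).trans hf⟩
  · exact tsum_nonneg fun s => smul_nonneg (le_max_right _ _) s.2.1
  · exact tsum_nonneg fun s => smul_nonneg (le_max_right _ _) s.2.1
  · rw [← (hsum f (fun r => max r 0) hp).tsum_sub (hsum f (fun r => max (-r) 0) hm)]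
    change ∑' s : S, f s • (s : X) = _
    refine tsum_congr fun s => ?_
    rw [← sub_smul]
    congr 1
    rcases le_total (f s) 0 with h | h
    · rw [max_eq_right h, max_eq_left (by linarith)]; ring
    · rw [max_eq_left h, max_eq_right (by linarith)]; ring

variable [CompleteSpace X] [IsOrderedModule ℝ X] [OrderClosedTopology X]

variable (X) in
/-- A constant `C > 0` such that a linear map that is bounded by `M` on the positive cone is
bounded by `C * M` on the whole space. -/
noncomputable def coneConst : ℝ := 2 * (exists_nonneg_sub_norm_le (X := X)).choose

variable (X) in
theorem coneConst_pos : 0 < coneConst X :=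
  mul_pos two_pos (exists_nonneg_sub_norm_le (X := X)).choose_spec.1

theorem norm_map_le_of_cone {Y : Type*} [NormedAddCommGroup Y] [NormedSpace ℝ Y] (T : X →ₗ[ℝ] Y)
    {M : ℝ} (hM : 0 ≤ M) (hT : ∀ u : X, 0 ≤ u → ‖T u‖ ≤ M * ‖u‖) (x : X) :
    ‖T x‖ ≤ coneConst X * M * ‖x‖ := by
  obtain ⟨a, b, ha, hb, h, ha', hb'⟩ :=
    (exists_nonneg_sub_norm_le (X := X)).choose_spec.2 x
  calc ‖T x‖ = ‖T a - T b‖ := by rw [h, map_sub]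
    _ ≤ ‖T a‖ + ‖T b‖ := norm_sub_le _ _
    _ ≤ M * ‖a‖ + M * ‖b‖ := add_le_add (hT a ha) (hT b hb)
    _ ≤ M * (_ * ‖x‖) + M * (_ * ‖x‖) :=
        add_le_add (mul_le_mul_of_nonneg_left ha' hM) (mul_le_mul_of_nonneg_left hb' hM)
    _ = coneConst X * M * ‖x‖ := by unfold coneConst; ring

/-- A linear map that is bounded on the positive cone is continuous. -/
noncomputable def mkContinuousOfCone {Y : Type*} [NormedAddCommGroup Y] [NormedSpace ℝ Y]
    (T : X →ₗ[ℝ] Y) (hT : ∃ M : ℝ, 0 ≤ M ∧ ∀ u : X, 0 ≤ u → ‖T u‖ ≤ M * ‖u‖) : X →L[ℝ] Y :=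
  ⟨T, AddMonoidHomClass.continuous_of_bound T (coneConst X * hT.choose)
    (norm_map_le_of_cone T hT.choose_spec.1 hT.choose_spec.2)⟩

end Cone

section Substochastic

variable {X : Type*} [NormedAddCommGroup X] [NormedSpace ℝ X] [PartialOrder X]

/-- A bounded operator is substochastic if it is positive, and contractive on the positive cone. -/
def SubstochasticOp (T : X →L[ℝ] X) : Prop :=
  ∀ u : X, 0 ≤ u → 0 ≤ T u ∧ ‖T u‖ ≤ ‖u‖

namespace SubstochasticOp

theorem one : SubstochasticOp (1 : X →L[ℝ] X) := fun _ hu => ⟨hu, le_rfl⟩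

theorem mul {S T : X →L[ℝ] X} (hS : SubstochasticOp S) (hT : SubstochasticOp T) :
    SubstochasticOp (S * T) := fun u hu =>
  ⟨(hS _ (hT u hu).1).1, (hS _ (hT u hu).1).2.trans (hT u hu).2⟩

theorem pow {T : X →L[ℝ] X} (hT : SubstochasticOp T) (n : ℕ) : SubstochasticOp (T ^ n) := by
  induction n with
  | zero => exact one
  | succ n ih => rw [pow_succ]; exact ih.mul hT

theorem of_tendsto [OrderClosedTopology X] {ι : Type*} {l : Filter ι} [l.NeBot]
    {F : ι → X →L[ℝ] X} (hF : ∀ i, SubstochasticOp (F i)) {T : X →L[ℝ] X}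
    (h : ∀ u, Tendsto (fun i => F i u) l (𝓝 (T u))) : SubstochasticOp T := fun u hu =>
  ⟨ge_of_tendsto' (h u) fun i => (hF i u hu).1,
    le_of_tendsto' (h u).norm fun i => (hF i u hu).2⟩

theorem norm_le [IsOrderedAddMonoid X] [AbstractStateSpace X] [CompleteSpace X]
    [IsOrderedModule ℝ X] [OrderClosedTopology X] {T : X →L[ℝ] X} (hT : SubstochasticOp T)
    (x : X) : ‖T x‖ ≤ coneConst X * ‖x‖ := by
  simpa using norm_map_le_of_cone (T : X →ₗ[ℝ] X) zero_le_one
    (fun u hu => by simpa using (hT u hu).2) x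

end SubstochasticOp

theorem pow_apply_le_pow_apply [IsOrderedAddMonoid X] {S T : X →L[ℝ] X}
    (hS : ∀ u, 0 ≤ u → 0 ≤ S u) (hST : ∀ u, 0 ≤ u → S u ≤ T u) (n : ℕ) :
    ∀ u, 0 ≤ u → 0 ≤ (S ^ n) u ∧ (S ^ n) u ≤ (T ^ n) u := by
  induction n with
  | zero => intro u hu; exact ⟨hu, le_rfl⟩
  | succ n ih =>
    intro u hu
    rw [pow_succ', pow_succ']
    refine ⟨hS _ (ih u hu).1, (hST _ (ih u hu).1).trans ?_⟩
    have h := (hS _ (sub_nonneg.2 (ih u hu).2)).trans (hST _ (sub_nonneg.2 (ih u hu).2))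
    rw [map_sub, sub_nonneg] at h
    exact h

end Substochastic

/-! ### Resolvents and Laplace transforms of substochastic semigroups -/

section Resolvent

variable {X : Type*} [NormedAddCommGroup X] [NormedSpace ℝ X]

/-- `R` is the inverse of `lam - H`, expressed through the graph of `H`. -/
structure IsResolvent (H : X →ₗ.[ℝ] X) (lam : ℝ) (R : X →L[ℝ] X) : Prop where
  mem_graph : ∀ x, (R x, lam • R x - x) ∈ H.graph
  left_inv : ∀ x y, (x, y) ∈ H.graph → R (lam • x - y) = x

namespace IsResolvent

variable {H : X →ₗ.[ℝ] X} {lam mu : ℝ} {R Q : X →L[ℝ] X}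

theorem apply_shift (h : IsResolvent H lam R) (v : H.domain) : R (shift H lam v) = v :=
  h.left_inv v (H v) (H.mem_graph v)

theorem mem_domain (h : IsResolvent H lam R) (x : X) : R x ∈ H.domain :=
  LinearPMap.mem_domain_of_mem_graph (h.mem_graph x)

theorem map_apply (h : IsResolvent H lam R) (x : X) :
    H ⟨R x, h.mem_domain x⟩ = lam • R x - x :=
  ((LinearPMap.image_iff (h.mem_domain x)).2 (h.mem_graph x)).symm

theorem shift_apply (h : IsResolvent H lam R) (x : X) :
    shift H lam ⟨R x, h.mem_domain x⟩ = x := by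
  change lam • R x - H ⟨R x, h.mem_domain x⟩ = x
  rw [h.map_apply, sub_sub_cancel]

theorem bijective (h : IsResolvent H lam R) : Function.Bijective (shift H lam) := by
  refine ⟨fun v w hvw => Subtype.ext ?_, fun x => ⟨_, h.shift_apply x⟩⟩
  rw [← h.apply_shift v, hvw, h.apply_shift]

theorem invShift_eq (h : IsResolvent H lam R) (x : X) :
    invShift H lam x = ⟨R x, h.mem_domain x⟩ := by
  rw [invShift, dif_pos h.bijective]
  apply h.bijective.1
  rw [h.shift_apply]
  exact (LinearEquiv.ofBijective (shift H lam) h.bijective).apply_symm_apply x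

theorem coe_invShift (h : IsResolvent H lam R) (x : X) : (invShift H lam x : X) = R x := by
  rw [h.invShift_eq]

theorem mem_realResolventSet (h : IsResolvent H lam R) : lam ∈ realResolventSet H :=
  ⟨h.bijective, ‖R‖, fun v => by
    conv_lhs => rw [← h.apply_shift v]
    exact R.le_opNorm _⟩

theorem unique (h : IsResolvent H lam R) (h' : IsResolvent H lam Q) : R = Q := by
  ext x
  rw [← h.coe_invShift, h'.coe_invShift]

theorem mem_graph_iff (h : IsResolvent H lam R) {x y : X} :
    (x, y) ∈ H.graph ↔ R (lam • x - y) = x := by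
  refine ⟨h.left_inv x y, fun hR => ?_⟩
  have := h.mem_graph (lam • x - y)
  rwa [hR, sub_sub_cancel] at this

theorem isClosed (h : IsResolvent H lam R) : H.IsClosed := by
  have : (H.graph : Set (X × X)) = {p | R (lam • p.1 - p.2) = p.1} := by
    ext p
    exact h.mem_graph_iff
  rw [LinearPMap.IsClosed, this]
  exact isClosed_eq (by fun_prop) continuous_fst

theorem injective (h : IsResolvent H lam R) : Function.Injective R := fun x y hxy => by
  rw [← h.shift_apply x, ← h.shift_apply y]
  congr 2

theorem resolvent_identity (h : IsResolvent H lam R) (h' : IsResolvent H mu Q) (x : X) :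
    R x - Q x = (mu - lam) • R (Q x) := by
  have h1 := h.left_inv _ _ (h'.mem_graph x)
  simp only [map_sub, map_smul] at h1
  rw [sub_smul]
  linear_combination (norm := module) h1

end IsResolvent

end Resolvent

section Semigroup

variable {X : Type*} [NormedAddCommGroup X] [NormedSpace ℝ X]

namespace C0Semigroup

theorem op_add_apply (S : C0Semigroup X) (s t : ℝ≥0) (x : X) :
    S.op (s + t) x = S.op s (S.op t x) := by
  rw [S.op_add]; rfl

theorem op_zero_apply (S : C0Semigroup X) (x : X) : S.op 0 x = x := by
  rw [S.op_zero]; rfl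

theorem op_comm_apply (S : C0Semigroup X) (s t : ℝ≥0) (x : X) :
    S.op s (S.op t x) = S.op t (S.op s x) := by
  rw [← op_add_apply, add_comm, op_add_apply]

theorem op_nsmul (S : C0Semigroup X) (t : ℝ≥0) (n : ℕ) : S.op (n • t) = S.op t ^ n := by
  induction n with
  | zero => rw [zero_smul, S.op_zero]; rfl
  | succ n ih => rw [succ_nsmul, S.op_add, ih, pow_succ]; rfl

/-- An orbit that is given by a function `F` of a real variable, differentiable at `0`, starts in the
domain of the generator. -/
theorem mem_graph_generator_of_hasDerivAt (S : C0Semigroup X) {F : ℝ → X} {x y : X}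
    (hF : HasDerivAt F y 0) (hS : ∀ t : ℝ≥0, S.op t x = F t) : (x, y) ∈ S.generator.graph := by
  rw [mem_graph_generator]
  have h1 := (hasDerivWithinAt_iff_tendsto_slope' (by simp)).1
    (hF.hasDerivWithinAt (s := Set.Ioi 0))
  have h2 : Tendsto (fun t : ℝ≥0 => (t : ℝ)) (𝓝[>] 0) (𝓝[>] 0) := by
    refine tendsto_nhdsWithin_iff.2 ⟨?_, ?_⟩
    · exact (NNReal.continuous_coe.tendsto' 0 0 rfl).mono_left nhdsWithin_le_nhds
    · filter_upwards [self_mem_nhdsWithin] with t ht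
      exact_mod_cast ht
  refine (h1.comp h2).congr fun t => ?_
  rw [Function.comp_apply, slope_def_module, sub_zero, ← hS, ← NNReal.coe_zero, ← hS,
    op_zero_apply]

end C0Semigroup

end Semigroup

section SubstochasticSemigroup

variable {X : Type*} [NormedAddCommGroup X] [NormedSpace ℝ X] [CompleteSpace X] [PartialOrder X]
  [IsOrderedAddMonoid X] [IsOrderedModule ℝ X] [OrderClosedTopology X] [AbstractStateSpace X]

namespace C0Semigroup

variable {S : C0Semigroup X}

theorem IsSubstochastic.norm_op_le (hS : S.IsSubstochastic) (t : ℝ≥0) (x : X) :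
    ‖S.op t x‖ ≤ coneConst X * ‖x‖ :=
  SubstochasticOp.norm_le (hS t) x

/-- For `t ≤ s` factor out the operator `S(t)`, which is bounded by `coneConst X`; what remains is
`S(s - t)`. -/
theorem IsSubstochastic.norm_op_sub_le (hS : S.IsSubstochastic) (s t : ℝ≥0) (x : X) :
    ‖S.op s x - S.op t x‖ ≤ coneConst X * ‖S.op (nndist s t) x - x‖ := by
  wlog h : t ≤ s generalizing s t
  · rw [nndist_comm, norm_sub_rev]
    exact this t s (le_of_not_ge h)
  obtain ⟨r, rfl⟩ := exists_add_of_le h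
  have hr : nndist (t + r) t = r := by
    apply NNReal.coe_injective
    rw [coe_nndist, NNReal.dist_eq, NNReal.coe_add, add_sub_cancel_left, NNReal.abs_eq]
  rw [hr, op_add_apply, ← map_sub]
  exact hS.norm_op_le _ _

theorem IsSubstochastic.continuous_op (hS : S.IsSubstochastic) (x : X) :
    Continuous fun t : ℝ≥0 => S.op t x := by
  refine continuous_iff_continuousAt.2 fun t => tendsto_iff_norm_sub_tendsto_zero.2 ?_
  refine squeeze_zero (fun _ => norm_nonneg _) (fun s => hS.norm_op_sub_le s t x) ?_
  have h1 : Tendsto (fun s : ℝ≥0 => nndist s t) (𝓝 t) (𝓝 0) := by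
    have : Continuous fun s : ℝ≥0 => nndist s t := by fun_prop
    exact this.tendsto' t 0 (nndist_self t)
  have h2 := (tendsto_iff_norm_sub_tendsto_zero.1 (S.tendsto_zero x)).comp h1
  simpa using h2.const_mul (coneConst X)

/-- The integrand of the Laplace transform of an orbit. -/
noncomputable def laplaceIntegrand (S : C0Semigroup X) (lam : ℝ) (x : X) (s : ℝ) : X :=
  Real.exp (-lam * s) • S.op s.toNNReal x

theorem IsSubstochastic.continuous_laplaceIntegrand (hS : S.IsSubstochastic) (lam : ℝ) (x : X) :
    Continuous (laplaceIntegrand S lam x) :=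
  Continuous.smul (by fun_prop) ((hS.continuous_op x).comp continuous_real_toNNReal)

open MeasureTheory in
theorem IsSubstochastic.integrableOn_laplaceIntegrand (hS : S.IsSubstochastic) {lam : ℝ}
    (hlam : 0 < lam) (x : X) : IntegrableOn (laplaceIntegrand S lam x) (Set.Ioi 0) := by
  refine Integrable.mono' ((integrableOn_exp_mul_Ioi (neg_neg_iff_pos.2 hlam) 0).mul_const
    (coneConst X * ‖x‖)) (hS.continuous_laplaceIntegrand lam x).aestronglyMeasurable
    (Eventually.of_forall fun s => ?_)
  rw [laplaceIntegrand, norm_smul, Real.norm_eq_abs, Real.abs_exp]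
  exact mul_le_mul_of_nonneg_left (hS.norm_op_le _ _) (Real.exp_pos _).le

/-- The Laplace transform of a substochastic semigroup. -/
noncomputable def laplaceLinear (S : C0Semigroup X) (hS : S.IsSubstochastic) (lam : ℝ)
    (hlam : 0 < lam) : X →ₗ[ℝ] X where
  toFun x := ∫ s in Set.Ioi (0 : ℝ), laplaceIntegrand S lam x s
  map_add' x y := by
    rw [← MeasureTheory.integral_add (hS.integrableOn_laplaceIntegrand hlam x)
      (hS.integrableOn_laplaceIntegrand hlam y)]
    simp [laplaceIntegrand]
  map_smul' c x := by
    rw [RingHom.id_apply, ← MeasureTheory.integral_smul]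
    simp only [laplaceIntegrand, map_smul]
    simp_rw [smul_comm c]

theorem laplaceLinear_nonneg (hS : S.IsSubstochastic) {lam : ℝ} (hlam : 0 < lam) {u : X}
    (hu : 0 ≤ u) : 0 ≤ laplaceLinear S hS lam hlam u :=
  MeasureTheory.integral_nonneg fun _ => smul_nonneg (Real.exp_pos _).le (hS _ u hu).1

theorem norm_laplaceLinear_le (hS : S.IsSubstochastic) {lam : ℝ} (hlam : 0 < lam) {u : X}
    (hu : 0 ≤ u) : ‖laplaceLinear S hS lam hlam u‖ ≤ lam⁻¹ * ‖u‖ := by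
  have h1 := MeasureTheory.norm_integral_le_of_norm_le
    ((integrableOn_exp_mul_Ioi (neg_neg_iff_pos.2 hlam) 0).mul_const ‖u‖)
    (f := laplaceIntegrand S lam u) (Eventually.of_forall fun s => by
      rw [laplaceIntegrand, norm_smul, Real.norm_eq_abs, Real.abs_exp]
      exact mul_le_mul_of_nonneg_left (hS _ u hu).2 (Real.exp_pos _).le)
  rw [MeasureTheory.integral_mul_const, integral_exp_mul_Ioi (neg_neg_iff_pos.2 hlam)] at h1
  refine h1.trans_eq ?_
  simp [neg_div_neg_eq]

/-- The Laplace transform of a substochastic semigroup, as a bounded operator. -/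
noncomputable def laplace (S : C0Semigroup X) (hS : S.IsSubstochastic) (lam : ℝ)
    (hlam : 0 < lam) : X →L[ℝ] X :=
  mkContinuousOfCone (laplaceLinear S hS lam hlam)
    ⟨lam⁻¹, (inv_pos.2 hlam).le, fun _ hu => norm_laplaceLinear_le hS hlam hu⟩

theorem laplace_apply (hS : S.IsSubstochastic) {lam : ℝ} (hlam : 0 < lam) (x : X) :
    laplace S hS lam hlam x = ∫ s in Set.Ioi (0 : ℝ), laplaceIntegrand S lam x s := rfl

theorem op_laplace_comm (hS : S.IsSubstochastic) {lam : ℝ} (hlam : 0 < lam) (t : ℝ≥0) (x : X) :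
    S.op t (laplace S hS lam hlam x) = laplace S hS lam hlam (S.op t x) := by
  rw [laplace_apply, laplace_apply,
    ← (S.op t).integral_comp_comm (hS.integrableOn_laplaceIntegrand hlam x)]
  simp only [laplaceIntegrand, map_smul]
  simp_rw [S.op_comm_apply t]

open MeasureTheory in
/-- Translating the Laplace integral. Differentiating the right-hand side at `t = 0` gives the
action of the generator on the Laplace transform. -/
theorem op_laplace (hS : S.IsSubstochastic) {lam : ℝ} (hlam : 0 < lam) (t : ℝ≥0) (x : X) :
    S.op t (laplace S hS lam hlam x) = Real.exp (lam * t) •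
      (laplace S hS lam hlam x - ∫ s in (0 : ℝ)..t, laplaceIntegrand S lam x s) := by
  have hint := hS.integrableOn_laplaceIntegrand hlam x
  have h1 : laplace S hS lam hlam x - ∫ s in (0 : ℝ)..t, laplaceIntegrand S lam x s =
      ∫ s in Set.Ioi (t : ℝ), laplaceIntegrand S lam x s := by
    rw [laplace_apply, ← intervalIntegral.integral_Ioi_sub_Ioi hint t.coe_nonneg, sub_sub_cancel]
  have h2 : ∫ s in Set.Ioi (t : ℝ), laplaceIntegrand S lam x s =
      ∫ s in Set.Ioi (0 : ℝ), laplaceIntegrand S lam x (s + t) := by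
    rw [← (measurePreserving_add_right volume (t : ℝ)).setIntegral_preimage_emb
      (measurableEmbedding_addRight (t : ℝ))]
    simp
  rw [h1, h2, laplace_apply, ← (S.op t).integral_comp_comm hint, ← integral_smul]
  refine setIntegral_congr_fun measurableSet_Ioi fun s hs => ?_
  have hs0 : (0 : ℝ) ≤ s := (Set.mem_Ioi.1 hs).le
  simp only [laplaceIntegrand, map_smul]
  rw [Real.toNNReal_add hs0 t.coe_nonneg, Real.toNNReal_coe, add_comm s.toNNReal,
    op_add_apply, smul_smul, ← Real.exp_add]
  congr 2
  ring

theorem isResolvent_laplace (hS : S.IsSubstochastic) {lam : ℝ} (hlam : 0 < lam) :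
    IsResolvent S.generator lam (laplace S hS lam hlam) := by
  have hmem : ∀ x, (laplace S hS lam hlam x, lam • laplace S hS lam hlam x - x) ∈
      S.generator.graph := fun x => by
    refine S.mem_graph_generator_of_hasDerivAt (F := fun t => Real.exp (lam * t) •
      (laplace S hS lam hlam x - ∫ s in (0 : ℝ)..t, laplaceIntegrand S lam x s)) ?_
      fun t => op_laplace hS hlam t x
    have h1 : HasDerivAt (fun t : ℝ => Real.exp (lam * t)) lam 0 := by
      simpa using ((hasDerivAt_id (0 : ℝ)).const_mul lam).exp
    have h2 : HasDerivAt (fun t : ℝ => ∫ s in (0 : ℝ)..t, laplaceIntegrand S lam x s)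
        (laplaceIntegrand S lam x 0) 0 :=
      ((hS.continuous_laplaceIntegrand lam x).integral_hasStrictDerivAt 0 0).hasDerivAt
    have h3 := h1.fun_smul (h2.const_sub (laplace S hS lam hlam x))
    have h4 : laplaceIntegrand S lam x 0 = x := by simp [laplaceIntegrand, op_zero_apply]
    refine h3.congr_deriv ?_
    rw [h4]
    simp only [mul_zero, Real.exp_zero, one_smul, intervalIntegral.integral_same, sub_zero]
    abel
  refine ⟨hmem, fun x y hxy => ?_⟩
  rw [mem_graph_generator] at hxy
  have h1 := ((laplace S hS lam hlam).continuous.tendsto y).comp hxy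
  have h2 := (S.mem_graph_generator _ _).1 (hmem x)
  have h3 : lam • laplace S hS lam hlam x - x = laplace S hS lam hlam y := by
    refine tendsto_nhds_unique h2 (h1.congr fun t => ?_)
    rw [Function.comp_apply, map_smul, map_sub, op_laplace_comm]
  rw [map_sub, map_smul, ← h3, sub_sub_cancel]

/-- The generator of a substochastic semigroup is densely defined: the means
`t⁻¹ ∫₀ᵗ exp (-s) S(s) x ds` belong to its domain. -/
theorem IsSubstochastic.dense_domain (hS : S.IsSubstochastic) :
    Dense (S.generator.domain : Set X) := fun x => by
  set J := laplace S hS 1 one_pos with hJ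
  have hR := isResolvent_laplace hS one_pos
  have h2 : HasDerivAt (fun t : ℝ => ∫ s in (0 : ℝ)..t, laplaceIntegrand S 1 x s)
      (laplaceIntegrand S 1 x 0) 0 :=
    ((hS.continuous_laplaceIntegrand 1 x).integral_hasStrictDerivAt 0 0).hasDerivAt
  have h4 : laplaceIntegrand S 1 x 0 = x := by simp [laplaceIntegrand, op_zero_apply]
  rw [h4] at h2
  have h1 := (hasDerivWithinAt_iff_tendsto_slope' (by simp)).1
    (h2.hasDerivWithinAt (s := Set.Ioi 0))
  refine mem_closure_of_tendsto h1 ?_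
  filter_upwards [self_mem_nhdsWithin] with t ht
  have h5 := op_laplace hS one_pos t.toNNReal x
  rw [Real.coe_toNNReal t (Set.mem_Ioi.1 ht).le] at h5
  have h6 : ∫ s in (0 : ℝ)..t, laplaceIntegrand S 1 x s =
      J x - Real.exp (-(1 * t)) • J (S.op t.toNNReal x) := by
    rw [hJ, ← op_laplace_comm, h5, smul_smul, ← Real.exp_add, neg_add_cancel, Real.exp_zero,
      one_smul, sub_sub_cancel]
  simp only [slope_def_module, intervalIntegral.integral_same, sub_zero]
  rw [h6]
  exact Submodule.smul_mem _ _ (Submodule.sub_mem _ (hR.mem_domain _)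
    (Submodule.smul_mem _ _ (hR.mem_domain _)))

end C0Semigroup

/-- The properties of the resolvent `R lam`, for `lam > 0`, of the generator of a substochastic
semigroup that characterize such resolvents. -/
structure IsSubstochasticResolvent (R : ℝ → X →L[ℝ] X) : Prop where
  nonneg : ∀ lam, 0 < lam → ∀ u, 0 ≤ u → 0 ≤ R lam u
  norm_le : ∀ lam, 0 < lam → ∀ u, 0 ≤ u → lam * ‖R lam u‖ ≤ ‖u‖
  identity : ∀ lam mu, 0 < lam → 0 < mu → ∀ x, R lam x - R mu x = (mu - lam) • R lam (R mu x)
  dense_range : ∀ lam, 0 < lam → DenseRange (R lam)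

theorem C0Semigroup.IsSubstochastic.exists_resolvent {S : C0Semigroup X}
    (hS : S.IsSubstochastic) : ∃ R : ℝ → X →L[ℝ] X, IsSubstochasticResolvent R ∧
      (∀ lam, 0 < lam → IsResolvent S.generator lam (R lam)) ∧
      ∀ lam, 0 < lam → ∀ t : ℝ≥0, Commute (S.op t) (R lam) := by
  classical
  let R : ℝ → X →L[ℝ] X := fun lam =>
    if h : 0 < lam then C0Semigroup.laplace S hS lam h else 0
  have hR : ∀ lam (h : 0 < lam), R lam = C0Semigroup.laplace S hS lam h := fun lam h => dif_pos h
  have hres : ∀ lam, 0 < lam → IsResolvent S.generator lam (R lam) := fun lam h => by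
    rw [hR lam h]; exact C0Semigroup.isResolvent_laplace hS h
  refine ⟨R, ⟨?_, ?_, ?_, ?_⟩, hres, ?_⟩
  · intro lam h u hu
    rw [hR lam h]
    exact C0Semigroup.laplaceLinear_nonneg hS h hu
  · intro lam h u hu
    rw [hR lam h, ← le_inv_mul_iff₀ h]
    exact C0Semigroup.norm_laplaceLinear_le hS h hu
  · intro lam mu h h' x
    exact (hres lam h).resolvent_identity (hres mu h') x
  · intro lam h
    refine hS.dense_domain.mono fun v hv => ?_
    exact ⟨_, (hres lam h).apply_shift ⟨v, hv⟩⟩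
  · intro lam h t
    ext x
    rw [hR lam h]
    exact C0Semigroup.op_laplace_comm hS h t x

end SubstochasticSemigroup

/-! ### Exponentials of bounded operators and comparison of semigroups -/

section Density

variable {X : Type*} [NormedAddCommGroup X] [NormedSpace ℝ X]

/-- Pointwise convergence to zero of a uniformly bounded family extends from a dense set. -/
theorem tendsto_zero_of_dense {ι : Type*} {l : Filter ι} {F : ι → X →L[ℝ] X} {C : ℝ}
    (hF : ∀ i x, ‖F i x‖ ≤ C * ‖x‖) {D : Set X} (hD : Dense D)
    (h : ∀ x ∈ D, Tendsto (fun i => F i x) l (𝓝 0)) (x : X) :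
    Tendsto (fun i => F i x) l (𝓝 0) := by
  rw [Metric.tendsto_nhds]
  intro ε hε
  have hC : 0 < |C| + 1 := by positivity
  obtain ⟨d, hd, hxd⟩ := Metric.dense_iff.1 hD x (ε / 2 / (|C| + 1)) (by positivity)
  rw [Metric.mem_ball, dist_comm, dist_eq_norm] at hd
  filter_upwards [(Metric.tendsto_nhds.1 (h d hxd)) (ε / 2) (by positivity)] with i hi
  rw [dist_zero_right] at hi ⊢
  calc ‖F i x‖ = ‖F i (x - d) + F i d‖ := by rw [← map_add, sub_add_cancel]
    _ ≤ ‖F i (x - d)‖ + ‖F i d‖ := norm_add_le _ _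
    _ ≤ (|C| + 1) * ‖x - d‖ + ‖F i d‖ := by
        gcongr
        refine (hF i _).trans ?_
        gcongr
        linarith [le_abs_self C]
    _ < ε / 2 + ε / 2 := by
        refine add_lt_add ?_ hi
        rw [lt_div_iff₀ hC] at hd
        linarith
    _ = ε := add_halves ε

end Density

section Exponential

variable {X : Type*} [NormedAddCommGroup X] [NormedSpace ℝ X] [CompleteSpace X]

open NormedSpace in
/-- The uniformly continuous semigroup generated by a bounded operator. -/
noncomputable def expSemigroup (L : X →L[ℝ] X) : C0Semigroup X where
  op t := exp ((t : ℝ) • L)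
  op_zero := by
    rw [NNReal.coe_zero, zero_smul, exp_zero]; rfl
  op_add s t := by
    let _ : NormedAlgebra ℚ (X →L[ℝ] X) := NormedAlgebra.restrictScalars ℚ ℝ _
    rw [NNReal.coe_add, add_smul, exp_add_of_commute]
    · rfl
    · exact ((Commute.refl L).smul_left _).smul_right _
  tendsto_zero x := by
    have h1 : Continuous fun t : ℝ≥0 => exp ((t : ℝ) • L) x :=
      (ContinuousLinearMap.apply ℝ X x).continuous.comp
        ((differentiable_exp_smul_const ℝ L).continuous.comp NNReal.continuous_coe)
    refine h1.tendsto' 0 x ?_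
    rw [NNReal.coe_zero, zero_smul, exp_zero]; rfl

theorem expSemigroup_op (L : X →L[ℝ] X) (t : ℝ≥0) :
    (expSemigroup L).op t = NormedSpace.exp ((t : ℝ) • L) := rfl

theorem expSemigroup_zero_op (t : ℝ≥0) (x : X) : (expSemigroup (0 : X →L[ℝ] X)).op t x = x := by
  rw [expSemigroup_op, smul_zero, NormedSpace.exp_zero]; rfl

theorem expSemigroup_mem_graph (L : X →L[ℝ] X) (x : X) :
    (x, L x) ∈ (expSemigroup L).generator.graph := by
  refine C0Semigroup.mem_graph_generator_of_hasDerivAt (expSemigroup L)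
    (F := fun t => NormedSpace.exp (t • L) x) ?_ fun _ => rfl
  have h := hasDerivAt_exp_smul_const (𝕂 := ℝ) L (0 : ℝ)
  rw [zero_smul, NormedSpace.exp_zero, one_mul] at h
  exact (ContinuousLinearMap.apply ℝ X x).hasFDerivAt.comp_hasDerivAt (0 : ℝ) h

theorem commute_expSemigroup {L T : X →L[ℝ] X} (h : Commute T L) (t : ℝ≥0) :
    Commute T ((expSemigroup L).op t) := by
  let _ : NormedAlgebra ℚ (X →L[ℝ] X) := NormedAlgebra.restrictScalars ℚ ℝ _
  exact (h.smul_right _).exp_right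

/-- The exponential series of `a • (P - 1)`, applied to a vector. -/
theorem hasSum_exp_smul_sub_one (P : X →L[ℝ] X) (a : ℝ) (x : X) :
    HasSum (fun n : ℕ => (Real.exp (-a) * ((n.factorial : ℝ)⁻¹ * a ^ n)) • (P ^ n) x)
      (NormedSpace.exp (a • (P - 1)) x) := by
  let _ : NormedAlgebra ℚ (X →L[ℝ] X) := NormedAlgebra.restrictScalars ℚ ℝ _
  have h1 : a • (P - 1) = algebraMap ℝ (X →L[ℝ] X) (-a) + a • P := by
    rw [Algebra.algebraMap_eq_smul_one, smul_sub, neg_smul]; abel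
  rw [h1, NormedSpace.exp_add_of_commute (Algebra.commute_algebraMap_left _ _),
    ← NormedSpace.algebraMap_exp_comm, ← Real.exp_eq_exp_ℝ, Algebra.algebraMap_eq_smul_one,
    smul_mul_assoc, one_mul]
  have h2 := (NormedSpace.exp_series_hasSum_exp' (𝕂 := ℝ) (a • P)).mapL
    (ContinuousLinearMap.apply ℝ X x)
  have h3 := h2.const_smul (Real.exp (-a))
  convert h3 using 2 with n
  · simp [smul_pow, mul_smul]
  · rfl

end Exponential

section Cone

variable {X : Type*} [NormedAddCommGroup X] [NormedSpace ℝ X] [CompleteSpace X] [PartialOrder X]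
  [IsOrderedAddMonoid X] [IsOrderedModule ℝ X] [OrderClosedTopology X]

theorem SubstochasticOp.exp_smul_sub_one {P : X →L[ℝ] X} (hP : SubstochasticOp P) {a : ℝ}
    (ha : 0 ≤ a) : SubstochasticOp (NormedSpace.exp (a • (P - 1))) := fun u hu => by
  have h1 := hasSum_exp_smul_sub_one P a u
  refine ⟨h1.nonneg fun n => smul_nonneg (by positivity) ((hP.pow n) u hu).1, ?_⟩
  have h2 : HasSum (fun n : ℕ => (Real.exp (-a) * ((n.factorial : ℝ)⁻¹ * a ^ n)) * ‖u‖)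
      (‖u‖) := by
    have h3 := (NormedSpace.exp_series_hasSum_exp' (𝕂 := ℝ) a).mul_left (Real.exp (-a))
    rw [← Real.exp_eq_exp_ℝ, ← Real.exp_add, neg_add_cancel, Real.exp_zero] at h3
    simpa using h3.mul_right ‖u‖
  rw [← h1.tsum_eq]
  refine tsum_of_norm_bounded h2 fun n => ?_
  rw [norm_smul, Real.norm_of_nonneg (by positivity)]
  exact mul_le_mul_of_nonneg_left ((hP.pow n) u hu).2 (by positivity)

/-- The exponential series of `a • P` has nonnegative coefficients, so `P ↦ exp (a • (P - 1))` is
monotone on positive operators. -/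
theorem exp_smul_sub_one_mono {P Q : X →L[ℝ] X} (hP : ∀ u, 0 ≤ u → 0 ≤ P u)
    (hPQ : ∀ u, 0 ≤ u → P u ≤ Q u) {a : ℝ} (ha : 0 ≤ a) {u : X} (hu : 0 ≤ u) :
    NormedSpace.exp (a • (P - 1)) u ≤ NormedSpace.exp (a • (Q - 1)) u :=
  hasSum_le (fun n => smul_le_smul_of_nonneg_left (pow_apply_le_pow_apply hP hPQ n u hu).2
    (by positivity)) (hasSum_exp_smul_sub_one P a u) (hasSum_exp_smul_sub_one Q a u)

variable [AbstractStateSpace X]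

/-- Two commuting substochastic semigroups are as close to each other as their generators are:
telescope `S(t) - T(t) = S(t / n) ^ n - T(t / n) ^ n` and let `n` tend to infinity. -/
theorem norm_op_sub_op_le {S T : C0Semigroup X} (hS : S.IsSubstochastic) (hT : T.IsSubstochastic)
    (hST : ∀ t, Commute (S.op t) (T.op t)) {x y z : X} (hy : (x, y) ∈ S.generator.graph)
    (hz : (x, z) ∈ T.generator.graph) (t : ℝ≥0) :
    ‖S.op t x - T.op t x‖ ≤ coneConst X * t * ‖y - z‖ := by
  rcases eq_or_ne t 0 with rfl | ht
  · rw [S.op_zero_apply, T.op_zero_apply, sub_self, norm_zero, NNReal.coe_zero, mul_zero, zero_mul]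
  have htpos : 0 < t := pos_iff_ne_zero.2 ht
  have hC := coneConst_pos X
  rw [C0Semigroup.mem_graph_generator] at hy hz
  have hlim : Tendsto (fun n : ℕ => t / (n + 1)) atTop (𝓝[>] 0) := by
    refine tendsto_nhdsWithin_iff.2 ⟨?_, Eventually.of_forall fun n => ?_⟩
    · rw [← NNReal.tendsto_coe, NNReal.coe_zero]
      have := (tendsto_one_div_add_atTop_nhds_zero_nat (𝕜 := ℝ)).const_mul (t : ℝ)
      rw [mul_zero] at this
      refine this.congr fun n => ?_
      push_cast
      ring
    · exact div_pos htpos (by positivity)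
  have h1 := ((hy.sub hz).comp hlim).norm.const_mul (coneConst X * t)
  refine ge_of_tendsto' h1 fun n => ?_
  set h : ℝ≥0 := t / (n + 1) with hh
  have hpos : 0 < h := div_pos htpos (by positivity)
  have htn : (n + 1) • h = t := by
    rw [hh, nsmul_eq_mul]; push_cast; field_simp
  have h2 : S.op t x - T.op t x =
      ∑ i ∈ Finset.range (n + 1), (S.op h ^ i * T.op h ^ (n + 1 - 1 - i)) (S.op h x - T.op h x) := by
    conv_lhs => rw [← htn]
    rw [S.op_nsmul, T.op_nsmul, ← sub_apply, ← (hST h).geom_sum₂_mul]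
    simp
  have h3 : ‖S.op t x - T.op t x‖ ≤
      ∑ _i ∈ Finset.range (n + 1), coneConst X * ‖S.op h x - T.op h x‖ := by
    rw [h2]
    exact norm_sum_le_of_le _ fun i _ =>
      (((show SubstochasticOp (S.op h) from hS h).pow i).mul
        ((show SubstochasticOp (T.op h) from hT h).pow _)).norm_le _
  refine h3.trans_eq ?_
  rw [Finset.sum_const, Finset.card_range, nsmul_eq_mul, Function.comp_apply, ← smul_sub,
    norm_smul, sub_sub_sub_cancel_right, norm_inv, Real.norm_of_nonneg h.coe_nonneg]
  have htr : (t : ℝ) = (n + 1) * h := by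
    rw [← htn, nsmul_eq_mul]; push_cast; ring
  have hne : (h : ℝ) ≠ 0 := by exact_mod_cast hpos.ne'
  rw [htr, ← hh]
  push_cast
  field_simp

end Cone

/-! ### Generation of substochastic semigroups -/

section HilleYosida

variable {X : Type*} [NormedAddCommGroup X] [NormedSpace ℝ X]

/-- The Yosida approximation `lam * (lam * R lam - 1)` for `lam = n + 1`. -/
noncomputable def yosida (R : ℝ → X →L[ℝ] X) (n : ℕ) : X →L[ℝ] X :=
  ((n : ℝ) + 1) • (((n : ℝ) + 1) • R (n + 1) - 1)

variable [CompleteSpace X] [PartialOrder X] [IsOrderedAddMonoid X] [IsOrderedModule ℝ X]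
  [OrderClosedTopology X] [AbstractStateSpace X]

variable {R : ℝ → X →L[ℝ] X}

namespace IsSubstochasticResolvent

theorem substochasticOp (hR : IsSubstochasticResolvent R) {lam : ℝ} (hlam : 0 < lam) :
    SubstochasticOp (lam • R lam) := fun u hu => by
  refine ⟨smul_nonneg hlam.le (hR.nonneg lam hlam u hu), ?_⟩
  rw [smul_apply, norm_smul, Real.norm_of_nonneg hlam.le]
  exact hR.norm_le lam hlam u hu

theorem commute (hR : IsSubstochasticResolvent R) {lam mu : ℝ} (hlam : 0 < lam) (hmu : 0 < mu) :
    Commute (R lam) (R mu) := by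
  ext x
  change R lam (R mu x) = R mu (R lam x)
  rcases eq_or_ne lam mu with rfl | hne
  · rfl
  have h1 := hR.identity lam mu hlam hmu x
  have h2 := hR.identity mu lam hmu hlam x
  refine smul_right_injective X (sub_ne_zero.2 hne.symm) ?_
  change (mu - lam) • _ = (mu - lam) • _
  rw [← h1, ← neg_sub lam mu, neg_smul, ← h2, neg_sub]

theorem norm_apply_le (hR : IsSubstochasticResolvent R) {lam : ℝ} (hlam : 0 < lam) (x : X) :
    ‖lam • R lam x‖ ≤ coneConst X * ‖x‖ :=
  (hR.substochasticOp hlam).norm_le x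

theorem substochastic_yosida (hR : IsSubstochasticResolvent R) (n : ℕ) :
    (expSemigroup (yosida R n)).IsSubstochastic := fun t => by
  have hn : (0 : ℝ) < n + 1 := by positivity
  have h : (expSemigroup (yosida R n)).op t = NormedSpace.exp
      (((t : ℝ) * ((n : ℝ) + 1)) • (((n : ℝ) + 1) • R (n + 1) - 1)) := by
    rw [expSemigroup_op, yosida, smul_smul]
  rw [h]
  exact (hR.substochasticOp hn).exp_smul_sub_one (by positivity)

theorem commute_yosida (hR : IsSubstochasticResolvent R) (m n : ℕ) :
    Commute (yosida R m) (yosida R n) := by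
  have hn : (0 : ℝ) < n + 1 := by positivity
  have hm : (0 : ℝ) < m + 1 := by positivity
  have h := (((hR.commute hm hn).smul_right ((n : ℝ) + 1)).smul_left ((m : ℝ) + 1))
  exact (((h.sub_left (Commute.one_left _)).sub_right (Commute.one_right _)).smul_right
    _).smul_left _

theorem tendsto_zero (hR : IsSubstochasticResolvent R) (x : X) :
    Tendsto (fun n : ℕ => R (n + 1) x) atTop (𝓝 0) := by
  have h1 := (tendsto_one_div_add_atTop_nhds_zero_nat (𝕜 := ℝ)).mul_const (coneConst X * ‖x‖)
  rw [zero_mul] at h1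
  refine squeeze_zero_norm (fun n => ?_) h1
  have hn : (0 : ℝ) < n + 1 := by positivity
  have h2 := hR.norm_apply_le hn x
  rw [norm_smul, Real.norm_of_nonneg hn.le] at h2
  rwa [one_div, le_inv_mul_iff₀ hn]

theorem tendsto_smul_self (hR : IsSubstochasticResolvent R) (x : X) :
    Tendsto (fun n : ℕ => ((n : ℝ) + 1) • R (n + 1) x) atTop (𝓝 x) := by
  have hC : ∀ (n : ℕ) (x : X), ‖(((n : ℝ) + 1) • R (n + 1) - 1) x‖ ≤ (coneConst X + 1) * ‖x‖ := by
    intro n x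
    have hn : (0 : ℝ) < n + 1 := by positivity
    rw [add_mul, one_mul]
    exact (norm_sub_le _ _).trans (add_le_add (hR.norm_apply_le hn x) le_rfl)
  have h := tendsto_zero_of_dense (l := atTop) hC (hR.dense_range 1 one_pos) (by
    rintro _ ⟨y, rfl⟩
    have h1 := (hR.tendsto_zero (R 1 y)).sub (hR.tendsto_zero y)
    rw [sub_zero] at h1
    refine h1.congr fun n => ?_
    have hn : (0 : ℝ) < n + 1 := by positivity
    have h2 := hR.identity _ _ hn one_pos y
    change _ = ((n : ℝ) + 1) • R (n + 1) (R 1 y) - R 1 y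
    linear_combination (norm := module) -h2) x
  have h' := h.add_const x
  rw [zero_add] at h'
  refine h'.congr fun n => ?_
  exact sub_add_cancel _ _

/-- On the range of `R lam` the Yosida approximations converge to the operator whose resolvent is
`R`, which maps `R lam y` to `lam • R lam y - y`. -/
theorem tendsto_yosida (hR : IsSubstochasticResolvent R) {lam : ℝ} (hlam : 0 < lam) (y : X) :
    Tendsto (fun n : ℕ => yosida R n (R lam y)) atTop (𝓝 (lam • R lam y - y)) := by
  refine (hR.tendsto_smul_self (lam • R lam y - y)).congr fun n => ?_
  have hn : (0 : ℝ) < n + 1 := by positivity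
  have h2 := hR.identity _ _ hn hlam y
  change _ = ((n : ℝ) + 1) • (((n : ℝ) + 1) • R (n + 1) (R lam y) - R lam y)
  rw [map_sub, map_smul]
  linear_combination (norm := module) (-((n : ℝ) + 1)) • h2

end IsSubstochasticResolvent

/-- A substochastic semigroup is the limit of the semigroups generated by the Yosida
approximations of its generator. -/
theorem tendsto_yosida_op {S : C0Semigroup X} (hS : S.IsSubstochastic)
    (hR : IsSubstochasticResolvent R)
    (hSR : ∀ lam, 0 < lam → IsResolvent S.generator lam (R lam)) (t : ℝ≥0) (x : X) :
    Tendsto (fun n => (expSemigroup (yosida R n)).op t x) atTop (𝓝 (S.op t x)) := by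
  obtain ⟨Q, -, hQ, hcomm⟩ := hS.exists_resolvent
  have hRS : ∀ (n : ℕ) (t : ℝ≥0),
      Commute ((expSemigroup (yosida R n)).op t) (S.op t) := fun n t => by
    have hn : (0 : ℝ) < n + 1 := by positivity
    have h := hcomm _ hn t
    rw [(hQ _ hn).unique (hSR _ hn)] at h
    exact (commute_expSemigroup
      (((h.smul_right _).sub_right (Commute.one_right _)).smul_right _) t).symm
  have h := tendsto_zero_of_dense (l := atTop)
    (F := fun n => (expSemigroup (yosida R n)).op t - S.op t) (C := coneConst X + coneConst X)
    (fun n x => by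
      rw [add_mul]
      exact (norm_sub_le _ _).trans
        (add_le_add ((hR.substochastic_yosida n).norm_op_le t x) (hS.norm_op_le t x)))
    (hR.dense_range 1 one_pos) (by
      rintro _ ⟨y, rfl⟩
      have h1 := ((hR.tendsto_yosida one_pos y).sub_const ((1 : ℝ) • R 1 y - y)).norm.const_mul
        (coneConst X * t)
      rw [sub_self, norm_zero, mul_zero] at h1
      exact squeeze_zero_norm (fun n => norm_op_sub_op_le (hR.substochastic_yosida n) hS (hRS n)
        (expSemigroup_mem_graph _ _) ((hSR 1 one_pos).mem_graph y) t) h1) x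
  have h' := h.add_const (S.op t x)
  rw [zero_add] at h'
  exact h'.congr fun n => sub_add_cancel _ _

theorem IsSubstochasticResolvent.cauchySeq_yosida_op (hR : IsSubstochasticResolvent R) (t : ℝ≥0)
    (x : X) : CauchySeq fun n => (expSemigroup (yosida R n)).op t x := by
  rw [cauchySeq_iff_tendsto_dist_atTop_0]
  have h := tendsto_zero_of_dense (l := atTop)
    (F := fun n : ℕ × ℕ => (expSemigroup (yosida R n.1)).op t - (expSemigroup (yosida R n.2)).op t)
    (C := coneConst X + coneConst X)
    (fun n x => by
      rw [add_mul]
      exact (norm_sub_le _ _).trans (add_le_add ((hR.substochastic_yosida n.1).norm_op_le t x)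
        ((hR.substochastic_yosida n.2).norm_op_le t x)))
    (hR.dense_range 1 one_pos) (by
      rintro _ ⟨y, rfl⟩
      have h1 := (cauchySeq_iff_tendsto_dist_atTop_0.1
        (hR.tendsto_yosida one_pos y).cauchySeq).const_mul (coneConst X * t)
      rw [mul_zero] at h1
      refine squeeze_zero_norm (fun n => ?_) h1
      rw [dist_eq_norm]
      exact norm_op_sub_op_le (hR.substochastic_yosida n.1) (hR.substochastic_yosida n.2)
        (fun t => commute_expSemigroup
          ((commute_expSemigroup (hR.commute_yosida n.2 n.1) t).symm) t)
        (expSemigroup_mem_graph _ _) (expSemigroup_mem_graph _ _) t) x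
  refine h.norm.congr' ?_ |>.trans (by rw [norm_zero])
  exact Eventually.of_forall fun n => (dist_eq_norm _ _).symm

/-- The Hille–Yosida theorem for substochastic semigroups: a family with the properties collected in
`IsSubstochasticResolvent` is the resolvent of the generator of a substochastic semigroup. The semigroup
is the limit of the exponentials of the Yosida approximations. -/
theorem IsSubstochasticResolvent.exists_semigroup (hR : IsSubstochasticResolvent R) :
    ∃ V : C0Semigroup X, V.IsSubstochastic ∧
      ∀ lam, 0 < lam → IsResolvent V.generator lam (R lam) := by
  have hlim : ∀ t : ℝ≥0, ∃ T : X →L[ℝ] X,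
      ∀ x, Tendsto (fun n => (expSemigroup (yosida R n)).op t x) atTop (𝓝 (T x)) := fun t => by
    choose f hf using fun x => cauchySeq_tendsto_of_complete (hR.cauchySeq_yosida_op t x)
    exact ⟨continuousLinearMapOfTendsto (fun n => (expSemigroup (yosida R n)).op t)
      (tendsto_pi_nhds.2 hf), hf⟩
  choose T hT using hlim
  have hTs : ∀ t, SubstochasticOp (T t) := fun t =>
    SubstochasticOp.of_tendsto (fun n => hR.substochastic_yosida n t) (hT t)
  have hsub : ∀ {lam : ℝ}, 0 < lam → ∀ (y : X) (t : ℝ≥0) (n : ℕ),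
      ‖(expSemigroup (yosida R n)).op t (R lam y) - T t (R lam y)‖ ≤
        coneConst X * t * ‖yosida R n (R lam y) - (lam • R lam y - y)‖ := fun hlam y t n => by
    refine le_of_tendsto_of_tendsto' (tendsto_const_nhds.sub (hT t _)).norm
      ((tendsto_const_nhds.sub (hR.tendsto_yosida hlam y)).norm.const_mul (coneConst X * t))
      fun m => ?_
    exact norm_op_sub_op_le (hR.substochastic_yosida n) (hR.substochastic_yosida m)
        (fun t => commute_expSemigroup
          ((commute_expSemigroup (hR.commute_yosida m n) t).symm) t)
        (expSemigroup_mem_graph _ _) (expSemigroup_mem_graph _ _) t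
  -- comparison with the constant semigroup controls the orbits near `t = 0`
  have hid : ∀ (y : X) (t : ℝ≥0), ‖T t (R 1 y) - R 1 y‖ ≤
      coneConst X * t * ‖(1 : ℝ) • R 1 y - y‖ := fun y t => by
    refine le_of_tendsto_of_tendsto' ((hT t (R 1 y)).sub_const (R 1 y)).norm
      ((hR.tendsto_yosida one_pos y).norm.const_mul (coneConst X * t)) fun n => ?_
    have h0 : (expSemigroup (0 : X →L[ℝ] X)).IsSubstochastic := fun t u hu => by
      rw [expSemigroup_zero_op]; exact ⟨hu, le_rfl⟩
    have := norm_op_sub_op_le (hR.substochastic_yosida n) h0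
      (fun t => commute_expSemigroup (Commute.zero_right _) t)
      (expSemigroup_mem_graph _ (R 1 y)) (expSemigroup_mem_graph 0 _) t
    rwa [expSemigroup_zero_op, zero_apply, sub_zero] at this
  let V : C0Semigroup X :=
    { op := T
      op_zero := by
        ext x
        refine tendsto_nhds_unique (hT 0 x) (tendsto_const_nhds.congr fun n => ?_)
        exact (C0Semigroup.op_zero_apply _ x).symm
      op_add := fun s t => by
        ext x
        refine tendsto_nhds_unique (hT (s + t) x) ?_
        have h1 : Tendsto (fun n => (expSemigroup (yosida R n)).op s
            ((expSemigroup (yosida R n)).op t x - T t x)) atTop (𝓝 0) := by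
          have h2 := (tendsto_iff_norm_sub_tendsto_zero.1 (hT t x)).const_mul (coneConst X)
          rw [mul_zero] at h2
          exact squeeze_zero_norm (fun n => (hR.substochastic_yosida n).norm_op_le s _) h2
        have h3 := h1.add (hT s (T t x))
        rw [zero_add] at h3
        refine h3.congr fun n => ?_
        rw [map_sub, sub_add_cancel, C0Semigroup.op_add_apply]
      tendsto_zero := fun x => by
        have h := tendsto_zero_of_dense (l := 𝓝 (0 : ℝ≥0)) (F := fun t => T t - 1)
          (C := coneConst X + 1) (fun t x => by
            rw [add_mul, one_mul]
            exact (norm_sub_le _ _).trans (add_le_add ((hTs t).norm_le x) le_rfl))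
          (hR.dense_range 1 one_pos) (by
            rintro _ ⟨y, rfl⟩
            refine squeeze_zero_norm (fun t => hid y t) ?_
            have : Continuous fun t : ℝ≥0 => coneConst X * t * ‖(1 : ℝ) • R 1 y - y‖ := by
              fun_prop
            exact this.tendsto' 0 0 (by simp)) x
        have h' := h.add_const x
        rw [zero_add] at h'
        exact h'.congr fun n => sub_add_cancel _ _ }
  have hV : V.IsSubstochastic := hTs
  -- by `hsub` the difference quotients of the approximations converge uniformly in `t`
  have hgraph : ∀ lam, 0 < lam → ∀ y, (R lam y, lam • R lam y - y) ∈ V.generator.graph := by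
    intro lam hlam y
    rw [C0Semigroup.mem_graph_generator]
    have hC := coneConst_pos X
    set z := lam • R lam y - y with hz
    rw [Metric.tendsto_nhds]
    intro ε hε
    have h1 := tendsto_iff_norm_sub_tendsto_zero.1 (hR.tendsto_yosida hlam y)
    obtain ⟨n, hn⟩ := (h1.eventually_lt_const
      (show 0 < ε / 2 / (coneConst X + 1) by positivity)).exists
    rw [lt_div_iff₀ (by positivity)] at hn
    have h2 := (C0Semigroup.mem_graph_generator _ _ _).1
      (expSemigroup_mem_graph (yosida R n) (R lam y))
    filter_upwards [Metric.tendsto_nhds.1 h2 (ε / 2) (by positivity), self_mem_nhdsWithin]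
      with t ht htpos
    have htpos' : (0 : ℝ) < t := by exact_mod_cast htpos
    rw [dist_eq_norm] at ht ⊢
    set E := (expSemigroup (yosida R n)).op t (R lam y) with hE
    have h3 : ‖(t : ℝ)⁻¹ • (T t (R lam y) - E)‖ ≤ coneConst X * ‖yosida R n (R lam y) - z‖ := by
      rw [norm_smul, norm_inv, Real.norm_of_nonneg htpos'.le, norm_sub_rev,
        inv_mul_le_iff₀ htpos']
      refine (hsub hlam y t n).trans_eq ?_
      ring
    calc ‖(t : ℝ)⁻¹ • (T t (R lam y) - R lam y) - z‖
        = ‖(t : ℝ)⁻¹ • (T t (R lam y) - E) +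
            ((t : ℝ)⁻¹ • (E - R lam y) - yosida R n (R lam y)) +
            (yosida R n (R lam y) - z)‖ := by
          congr 1
          module
      _ ≤ coneConst X * ‖yosida R n (R lam y) - z‖ +
            ‖(t : ℝ)⁻¹ • (E - R lam y) - yosida R n (R lam y)‖ +
            ‖yosida R n (R lam y) - z‖ :=
          (norm_add_le _ _).trans (add_le_add ((norm_add_le _ _).trans
            (add_le_add h3 le_rfl)) le_rfl)
      _ < ε := by linarith
  obtain ⟨Q, -, hQ, -⟩ := hV.exists_resolvent
  refine ⟨V, hV, fun lam hlam => ?_⟩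
  have hRQ : R lam = Q lam := by
    ext y
    have := (hQ lam hlam).left_inv _ _ (hgraph lam hlam y)
    rw [sub_sub_cancel] at this
    exact this.symm
  rw [hRQ]
  exact hQ lam hlam

/-- Substochastic semigroups are ordered as their resolvents are. -/
theorem op_le_op_of_resolvent_le {S T : C0Semigroup X} (hS : S.IsSubstochastic)
    (hT : T.IsSubstochastic) {P Q : ℝ → X →L[ℝ] X}
    (hP : IsSubstochasticResolvent P) (hQ : IsSubstochasticResolvent Q)
    (hSP : ∀ lam, 0 < lam → IsResolvent S.generator lam (P lam))
    (hTQ : ∀ lam, 0 < lam → IsResolvent T.generator lam (Q lam))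
    (hPQ : ∀ lam, 0 < lam → ∀ u, 0 ≤ u → P lam u ≤ Q lam u) (t : ℝ≥0) {u : X} (hu : 0 ≤ u) :
    S.op t u ≤ T.op t u := by
  refine le_of_tendsto_of_tendsto' (tendsto_yosida_op hS hP hSP t u)
    (tendsto_yosida_op hT hQ hTQ t u) fun n => ?_
  have hn : (0 : ℝ) < n + 1 := by positivity
  rw [expSemigroup_op, expSemigroup_op, yosida, yosida, smul_smul, smul_smul]
  exact exp_smul_sub_one_mono (fun u hu => (hP.substochasticOp hn u hu).1)
    (fun u hu => smul_le_smul_of_nonneg_left (hPQ _ hn u hu) hn.le) (by positivity) hu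

end HilleYosida

/-! ### Resolvent of the minimal semigroup -/

section GeometricSum

variable {X : Type*} [NormedAddCommGroup X] [NormedSpace ℝ X]

theorem sum_pow_apply_sub_map (P : X →L[ℝ] X) (x : X) (N : ℕ) :
    ∑ n ∈ Finset.range N, (P ^ n) x - P (∑ n ∈ Finset.range N, (P ^ n) x) = x - (P ^ N) x := by
  rw [map_sum, ← Finset.sum_sub_distrib]
  have h := Finset.sum_range_sub' (fun n => (P ^ n) x) N
  rw [pow_zero] at h
  refine Eq.trans (Finset.sum_congr rfl fun n _ => ?_) h
  rw [pow_succ']; rfl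

end GeometricSum

section Perturbation

variable {X : Type*} [NormedAddCommGroup X] [NormedSpace ℝ X] [PartialOrder X]
  [IsOrderedAddMonoid X] [AbstractStateSpace X]

/-- The resolvents `R lam = (lam - A)⁻¹` and the operators `K lam = B (lam - A)⁻¹` of a
perturbation problem, described without reference to the domain of `A`. The last two fields say
that `B` is positive and that `⟨Ψ, (A + B) v⟩ ≤ 0` for the positive elements `v = R lam z` of the
domain. -/
structure IsKatoPair (R K : ℝ → X →L[ℝ] X) : Prop where
  resolvent : IsSubstochasticResolvent R
  identity : ∀ lam mu, 0 < lam → 0 < mu → ∀ x, K lam x - K mu x = (mu - lam) • K lam (R mu x)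
  nonneg : ∀ lam, 0 < lam → ∀ z, 0 ≤ R lam z → 0 ≤ K lam z
  loss : ∀ lam, 0 < lam → ∀ z, 0 ≤ R lam z → Psi X (K lam z) + lam * Psi X (R lam z) ≤ Psi X z

namespace IsKatoPair

variable {R K : ℝ → X →L[ℝ] X} {lam mu : ℝ}

theorem map_nonneg (h : IsKatoPair R K) (hlam : 0 < lam) {u : X} (hu : 0 ≤ u) : 0 ≤ K lam u :=
  h.nonneg lam hlam u (h.resolvent.nonneg lam hlam u hu)

theorem norm_add_le (h : IsKatoPair R K) (hlam : 0 < lam) {u : X} (hu : 0 ≤ u) :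
    ‖K lam u‖ + lam * ‖R lam u‖ ≤ ‖u‖ := by
  have hR := h.resolvent.nonneg lam hlam u hu
  have := h.loss lam hlam u hR
  rwa [Psi_of_nonneg _ hR, Psi_of_nonneg _ (h.map_nonneg hlam hu), Psi_of_nonneg _ hu] at this

theorem substochasticOp (h : IsKatoPair R K) (hlam : 0 < lam) : SubstochasticOp (K lam) :=
  fun u hu => ⟨h.map_nonneg hlam hu, by
    have := h.norm_add_le hlam hu
    have := mul_nonneg hlam.le (norm_nonneg (R lam u))
    linarith⟩

theorem pow_nonneg (h : IsKatoPair R K) (hlam : 0 < lam) {u : X} (hu : 0 ≤ u) (n : ℕ) :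
    0 ≤ (K lam ^ n) u :=
  ((h.substochasticOp hlam).pow n u hu).1

/-- The telescoped norm balance of the iteration. -/
theorem sum_norm_add_le (h : IsKatoPair R K) (hlam : 0 < lam) {u : X} (hu : 0 ≤ u) (N : ℕ) :
    lam * ∑ n ∈ Finset.range N, ‖R lam ((K lam ^ n) u)‖ + ‖(K lam ^ N) u‖ ≤ ‖u‖ := by
  induction N with
  | zero => simp
  | succ N ih =>
    have h1 := h.norm_add_le hlam (h.pow_nonneg hlam hu N)
    rw [Finset.sum_range_succ, pow_succ']
    change _ + ‖K lam ((K lam ^ N) u)‖ ≤ _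
    linarith

theorem summable_norm_of_nonneg (h : IsKatoPair R K) (hlam : 0 < lam) {u : X} (hu : 0 ≤ u) :
    Summable fun n => ‖R lam ((K lam ^ n) u)‖ := by
  refine summable_of_sum_range_le (c := lam⁻¹ * ‖u‖) (fun _ => norm_nonneg _) fun N => ?_
  rw [le_inv_mul_iff₀ hlam]
  have := h.sum_norm_add_le hlam hu N
  linarith [norm_nonneg ((K lam ^ N) u)]

variable [CompleteSpace X]

theorem summable (h : IsKatoPair R K) (hlam : 0 < lam) (x : X) :
    Summable fun n => R lam ((K lam ^ n) x) := by
  obtain ⟨a, b, ha, hb, rfl⟩ := AbstractStateSpace.generating x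
  simp only [map_sub]
  exact (h.summable_norm_of_nonneg hlam ha).of_norm.sub (h.summable_norm_of_nonneg hlam hb).of_norm

variable [IsOrderedModule ℝ X] [OrderClosedTopology X]

theorem apply_le_of_le (h : IsKatoPair R K) (hlam : 0 < lam) (hle : lam ≤ mu) {u : X}
    (hu : 0 ≤ u) : K mu u ≤ K lam u := by
  have hmu := hlam.trans_le hle
  rw [← sub_nonneg, h.identity lam mu hlam hmu]
  exact smul_nonneg (sub_nonneg.2 hle)
    (h.map_nonneg hlam (h.resolvent.nonneg mu hmu u hu))

theorem resolvent_apply_le_of_le (h : IsKatoPair R K) (hlam : 0 < lam) (hle : lam ≤ mu) {u : X}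
    (hu : 0 ≤ u) : R mu u ≤ R lam u := by
  have hmu := hlam.trans_le hle
  rw [← sub_nonneg, h.resolvent.identity lam mu hlam hmu]
  exact smul_nonneg (sub_nonneg.2 hle)
    (h.resolvent.nonneg lam hlam _ (h.resolvent.nonneg mu hmu u hu))

theorem pow_apply_le_of_le (h : IsKatoPair R K) (hlam : 0 < lam) (hle : lam ≤ mu) {u : X}
    (hu : 0 ≤ u) (n : ℕ) : (K mu ^ n) u ≤ (K lam ^ n) u :=
  (pow_apply_le_pow_apply (fun _ hv => h.map_nonneg (hlam.trans_le hle) hv)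
    (fun _ hv => h.apply_le_of_le hlam hle hv) n u hu).2

theorem term_le_of_le (h : IsKatoPair R K) (hlam : 0 < lam) (hle : lam ≤ mu) {u : X}
    (hu : 0 ≤ u) (n : ℕ) : R mu ((K mu ^ n) u) ≤ R lam ((K lam ^ n) u) := by
  have hmu := hlam.trans_le hle
  refine (h.resolvent_apply_le_of_le hlam hle (h.pow_nonneg hmu hu n)).trans ?_
  rw [← sub_nonneg, ← map_sub]
  exact h.resolvent.nonneg lam hlam _ (sub_nonneg.2 (h.pow_apply_le_of_le hlam hle hu n))

/-- `R mu x = R lam x'` with `x' = (lam - A) R mu x`. -/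
theorem resolvent_shift (h : IsKatoPair R K) (hlam : 0 < lam) (hmu : 0 < mu) (x : X) :
    R lam (x + (lam - mu) • R mu x) = R mu x := by
  have := h.resolvent.identity lam mu hlam hmu x
  rw [map_add, map_smul]
  linear_combination (norm := module) this

theorem apply_shift (h : IsKatoPair R K) (hlam : 0 < lam) (hmu : 0 < mu) (x : X) :
    K lam (x + (lam - mu) • R mu x) = K mu x := by
  have := h.identity lam mu hlam hmu x
  rw [map_add, map_smul]
  linear_combination (norm := module) this

/-- The sums `∑ R (K ^ n x)` are bounded operators. -/
theorem exists_sum (h : IsKatoPair R K) : ∃ G : ℝ → X →L[ℝ] X, ∀ lam, 0 < lam → ∀ x,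
    HasSum (fun n => R lam ((K lam ^ n) x)) (G lam x) := by
  have key : ∀ lam : ℝ, ∃ T : X →L[ℝ] X, 0 < lam → ∀ x,
      HasSum (fun n => R lam ((K lam ^ n) x)) (T x) := fun lam => by
    by_cases hlam : 0 < lam
    · let T : X →ₗ[ℝ] X :=
        { toFun := fun x => ∑' n, R lam ((K lam ^ n) x)
          map_add' := fun x y => by
            rw [← (h.summable hlam x).tsum_add (h.summable hlam y)]
            simp only [map_add]
          map_smul' := fun c x => by
            rw [RingHom.id_apply, ← (h.summable hlam x).tsum_const_smul]
            simp only [map_smul] }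
      refine ⟨mkContinuousOfCone T ⟨lam⁻¹, (inv_pos.2 hlam).le, fun u hu => ?_⟩,
        fun _ x => (h.summable hlam x).hasSum⟩
      refine (norm_tsum_le_tsum_norm (h.summable_norm_of_nonneg hlam hu)).trans ?_
      refine Real.tsum_le_of_sum_range_le (fun _ => norm_nonneg _) fun N => ?_
      rw [le_inv_mul_iff₀ hlam]
      have := h.sum_norm_add_le hlam hu N
      linarith [norm_nonneg ((K lam ^ N) u)]
    · exact ⟨0, fun h => absurd h hlam⟩
  choose G hG using key
  exact ⟨G, hG⟩

end IsKatoPair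

/-- The family `G lam = ∑ R lam (K lam) ^ n` together with the pair that it comes from. -/
structure IsKatoSum (R K G : ℝ → X →L[ℝ] X) : Prop extends IsKatoPair R K where
  hasSum : ∀ lam, 0 < lam → ∀ x, HasSum (fun n => R lam ((K lam ^ n) x)) (G lam x)

namespace IsKatoSum

variable {R K G : ℝ → X →L[ℝ] X} {lam mu : ℝ}

variable [CompleteSpace X] [IsOrderedModule ℝ X] [OrderClosedTopology X]

theorem sum_nonneg (h : IsKatoSum R K G) (hlam : 0 < lam) {u : X} (hu : 0 ≤ u) : 0 ≤ G lam u :=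
  (h.hasSum lam hlam u).nonneg fun n =>
    h.resolvent.nonneg lam hlam _ (h.pow_nonneg hlam hu n)

theorem norm_sum_le (h : IsKatoSum R K G) (hlam : 0 < lam) {u : X} (hu : 0 ≤ u) :
    lam * ‖G lam u‖ ≤ ‖u‖ := by
  have h1 := (h.hasSum lam hlam u).tendsto_sum_nat.norm.const_mul lam
  refine le_of_tendsto' h1 fun N => ?_
  have h2 := h.sum_norm_add_le hlam hu N
  have h3 := mul_le_mul_of_nonneg_left
    (_root_.norm_sum_le (Finset.range N) fun n => R lam ((K lam ^ n) u)) hlam.le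
  linarith [norm_nonneg ((K lam ^ N) u)]

/-- The series for `G lam x`, split after `N` terms. -/
theorem eq_sum_add (h : IsKatoSum R K G) (hlam : 0 < lam) (x : X) (N : ℕ) :
    G lam x = ∑ n ∈ Finset.range N, R lam ((K lam ^ n) x) + G lam ((K lam ^ N) x) := by
  have h1 := (h.hasSum lam hlam x).summable.sum_add_tsum_nat_add N
  rw [(h.hasSum lam hlam x).tsum_eq] at h1
  rw [← h1]
  congr 1
  refine (HasSum.tsum_eq ?_)
  refine (h.hasSum lam hlam ((K lam ^ N) x)).congr_fun fun n => ?_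
  rw [pow_add]; rfl

/-- `G lam` inverts `lam - A - B` on `R lam x`, since `(lam - A - B) R lam x = x - K lam x`. -/
theorem apply_sub (h : IsKatoSum R K G) (hlam : 0 < lam) (x : X) :
    G lam (x - K lam x) = R lam x := by
  have := h.eq_sum_add hlam x 1
  rw [Finset.sum_range_one, pow_zero, pow_one] at this
  rw [map_sub, this]
  exact add_sub_cancel_right _ _

/-- `G lam` inverts `lam - A - B` on `R mu x`. -/
theorem apply_shift_sub (h : IsKatoSum R K G) (hlam : 0 < lam) (hmu : 0 < mu) (x : X) :
    G lam (x + (lam - mu) • R mu x - K mu x) = R mu x := by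
  have := h.apply_sub hlam (x + (lam - mu) • R mu x)
  rwa [h.apply_shift hlam hmu, h.resolvent_shift hlam hmu] at this

theorem apply_le_of_le (h : IsKatoSum R K G) (hlam : 0 < lam) (hle : lam ≤ mu) {u : X}
    (hu : 0 ≤ u) : G mu u ≤ G lam u :=
  hasSum_le (fun n => h.term_le_of_le hlam hle hu n) (h.hasSum mu (hlam.trans_le hle) u)
    (h.hasSum lam hlam u)

theorem map_mono (h : IsKatoSum R K G) (hlam : 0 < lam) {u v : X} (huv : u ≤ v) :
    G lam u ≤ G lam v := by
  rw [← sub_nonneg, ← map_sub]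
  exact h.sum_nonneg hlam (sub_nonneg.2 huv)

theorem tendsto_apply_pow_self (h : IsKatoSum R K G) (hlam : 0 < lam) (x : X) :
    Tendsto (fun N => G lam ((K lam ^ N) x)) atTop (𝓝 0) := by
  have h1 := (h.hasSum lam hlam x).tendsto_sum_nat.const_sub (G lam x)
  rw [sub_self] at h1
  refine h1.congr fun N => ?_
  conv_lhs => rw [h.eq_sum_add hlam x N]
  exact add_sub_cancel_left _ _

/-- On the cone both `K` and `G` are antitone in the parameter, so `G lam (K mu ^ N u)` is dominated
by the corresponding expression with the smaller of the two parameters in both places. -/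
theorem tendsto_apply_pow (h : IsKatoSum R K G) (hlam : 0 < lam) (hmu : 0 < mu) (x : X) :
    Tendsto (fun N => G lam ((K mu ^ N) x)) atTop (𝓝 0) := by
  have key : ∀ u : X, 0 ≤ u → Tendsto (fun N => G lam ((K mu ^ N) u)) atTop (𝓝 0) := by
    intro u hu
    rcases le_total lam mu with hle | hle
    · refine squeeze_zero_norm (fun N => ?_)
        (tendsto_zero_iff_norm_tendsto_zero.1 (h.tendsto_apply_pow_self hlam u))
      exact norm_le_norm_of_nonneg_of_le (h.sum_nonneg hlam (h.pow_nonneg hmu hu N))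
        (h.map_mono hlam (h.pow_apply_le_of_le hlam hle hu N))
    · refine squeeze_zero_norm (fun N => ?_)
        (tendsto_zero_iff_norm_tendsto_zero.1 (h.tendsto_apply_pow_self hmu u))
      exact norm_le_norm_of_nonneg_of_le (h.sum_nonneg hlam (h.pow_nonneg hmu hu N))
        (h.apply_le_of_le hmu hle (h.pow_nonneg hmu hu N))
  obtain ⟨a, b, ha, hb, rfl⟩ := AbstractStateSpace.generating x
  have := (key a ha).sub (key b hb)
  rw [sub_zero] at this
  exact this.congr fun N => by rw [map_sub, map_sub]

/-- The resolvent identity for `G`: apply `apply_shift_sub` to the partial sums of `G mu x`. -/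
theorem sum_identity (h : IsKatoSum R K G) (hlam : 0 < lam) (hmu : 0 < mu) (x : X) :
    G lam x - G mu x = (mu - lam) • G lam (G mu x) := by
  have h1 : Tendsto (fun N => ∑ n ∈ Finset.range N, R mu ((K mu ^ n) x)) atTop (𝓝 (G mu x)) :=
    (h.hasSum mu hmu x).tendsto_sum_nat
  have h2 := (((G lam).continuous.tendsto _).comp h1).const_smul (lam - mu)
  have h3 := ((h.tendsto_apply_pow hlam hmu x).const_sub (G lam x)).add h2
  have h4 := tendsto_nhds_unique (h3.congr fun N => ?_) h1
  · rw [sub_zero] at h4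
    rw [← neg_sub lam mu]
    linear_combination (norm := module) h4
  · have h5 := h.apply_shift_sub hlam hmu (∑ n ∈ Finset.range N, (K mu ^ n) x)
    rw [add_sub_right_comm, sum_pow_apply_sub_map, map_add, map_sub, map_smul, map_sum] at h5
    exact h5

theorem isSubstochasticResolvent (h : IsKatoSum R K G) : IsSubstochasticResolvent G where
  nonneg _ hlam _ hu := h.sum_nonneg hlam hu
  norm_le _ hlam _ hu := h.norm_sum_le hlam hu
  identity _ _ hlam hmu x := h.sum_identity hlam hmu x
  dense_range lam hlam := (h.resolvent.dense_range lam hlam).mono (by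
    rintro _ ⟨x, rfl⟩
    exact ⟨_, h.apply_sub hlam x⟩)

/-- The family `G` is the smallest positive one that inverts `lam - A - B` on the domain of `A`. -/
theorem sum_le (h : IsKatoSum R K G) (hlam : 0 < lam) {Q : X →L[ℝ] X}
    (hQ : ∀ u, 0 ≤ u → 0 ≤ Q u) (hQK : ∀ x, Q (x - K lam x) = R lam x) {u : X} (hu : 0 ≤ u) :
    G lam u ≤ Q u := by
  refine le_of_tendsto' (h.hasSum lam hlam u).tendsto_sum_nat fun N => ?_
  rw [← map_sum, ← hQK, sum_pow_apply_sub_map, map_sub]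
  exact sub_le_self _ (hQ _ (h.pow_nonneg hlam hu N))

end IsKatoSum

end Perturbation

/-! ### The minimal semigroup -/

section Generation

variable {X : Type*} [NormedAddCommGroup X] [NormedSpace ℝ X] [CompleteSpace X]
  [PartialOrder X] [IsOrderedAddMonoid X] [IsOrderedModule ℝ X] [OrderClosedTopology X]
  [AbstractStateSpace X]

theorem mem_graph_perturbed {A : X →ₗ.[ℝ] X} {B : A.domain →ₗ[ℝ] X} {p : X × X} :
    p ∈ (perturbed A B).graph ↔ ∃ v : A.domain, p = ((v : X), A v + B v) := by
  rw [LinearPMap.mem_graph_iff']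
  exact ⟨fun ⟨v, hv⟩ => ⟨v, hv.symm⟩, fun ⟨v, hv⟩ => ⟨v, hv.symm⟩⟩

theorem iterOp_apply {A : X →ₗ.[ℝ] X} {B : A.domain →ₗ[ℝ] X} {lam : ℝ} {R : X →L[ℝ] X}
    (hR : IsResolvent A lam R) (x : X) :
    iterOp A B lam x = B ⟨R x, hR.mem_domain x⟩ := by
  rw [iterOp, LinearMap.comp_apply, hR.invShift_eq]

theorem iterOp_shift {A : X →ₗ.[ℝ] X} {B : A.domain →ₗ[ℝ] X} {lam : ℝ} {R : X →L[ℝ] X}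
    (hR : IsResolvent A lam R) (v : A.domain) : iterOp A B lam (shift A lam v) = B v := by
  rw [iterOp_apply hR]
  congr 1
  exact Subtype.ext (hR.apply_shift v)

/-- The operators of a perturbation problem form a Kato pair. -/
theorem exists_isKatoPair {A : X →ₗ.[ℝ] X} {B : A.domain →ₗ[ℝ] X} {R : ℝ → X →L[ℝ] X}
    (hRs : IsSubstochasticResolvent R) (hR : ∀ lam, 0 < lam → IsResolvent A lam (R lam))
    (hB : ∀ u : A.domain, 0 ≤ (u : X) → 0 ≤ B u)
    (hAB : ∀ u : A.domain, 0 ≤ (u : X) → Psi X (A u + B u) ≤ 0) :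
    ∃ K : ℝ → X →L[ℝ] X, (∀ lam, 0 < lam → ∀ x, K lam x = iterOp A B lam x) ∧
      IsKatoPair R K := by
  have hloss : ∀ lam, 0 < lam → ∀ z, 0 ≤ R lam z →
      Psi X (iterOp A B lam z) + lam * Psi X (R lam z) ≤ Psi X z := fun lam hlam z hz => by
    have h1 := hAB ⟨R lam z, (hR lam hlam).mem_domain z⟩ hz
    rw [(hR lam hlam).map_apply, ← iterOp_apply (hR lam hlam)] at h1
    simp only [map_add, map_sub, map_smul, smul_eq_mul] at h1
    linarith
  have hpos : ∀ lam, 0 < lam → ∀ z, 0 ≤ R lam z → 0 ≤ iterOp A B lam z := fun lam hlam z hz => by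
    rw [iterOp_apply (hR lam hlam)]
    exact hB _ hz
  have key : ∀ lam : ℝ, ∃ T : X →L[ℝ] X, 0 < lam → ∀ x, T x = iterOp A B lam x := fun lam => by
    by_cases hlam : 0 < lam
    · refine ⟨mkContinuousOfCone (iterOp A B lam) ⟨1, zero_le_one, fun u hu => ?_⟩,
        fun _ x => rfl⟩
      have hRu := hRs.nonneg lam hlam u hu
      have h1 := hloss lam hlam u hRu
      rw [Psi_of_nonneg _ hRu, Psi_of_nonneg _ (hpos lam hlam u hRu), Psi_of_nonneg _ hu] at h1
      have := mul_nonneg hlam.le (norm_nonneg (R lam u))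
      linarith
    · exact ⟨0, fun h => absurd h hlam⟩
  choose K hK using key
  refine ⟨K, hK, hRs, ?_, ?_, ?_⟩
  · intro lam mu hlam hmu x
    rw [hK lam hlam, hK mu hmu, hK lam hlam, iterOp_apply (hR lam hlam),
      iterOp_apply (hR mu hmu), iterOp_apply (hR lam hlam), ← map_sub, ← map_smul]
    congr 1
    exact Subtype.ext (hRs.identity lam mu hlam hmu x)
  · intro lam hlam z hz
    rw [hK lam hlam]
    exact hpos lam hlam z hz
  · intro lam hlam z hz
    rw [hK lam hlam]
    exact hloss lam hlam z hz

/-- An operator with resolvent `Q` extends `A + B` if and only if `Q` inverts `lam - A - B` on the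
domain of `A`. -/
theorem perturbed_le_iff {A H : X →ₗ.[ℝ] X} {B : A.domain →ₗ[ℝ] X} {lam : ℝ} {R K Q : X →L[ℝ] X}
    (hR : IsResolvent A lam R) (hK : ∀ x, K x = iterOp A B lam x) (hQ : IsResolvent H lam Q) :
    perturbed A B ≤ H ↔ ∀ x, Q (x - K x) = R x := by
  rw [← LinearPMap.le_graph_iff]
  constructor
  · intro h x
    have h1 : (R x, lam • R x - x + K x) ∈ H.graph := h (mem_graph_perturbed.2
      ⟨⟨R x, hR.mem_domain x⟩, by rw [hR.map_apply, hK, iterOp_apply hR]⟩)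
    have h2 := hQ.left_inv _ _ h1
    rwa [show lam • R x - (lam • R x - x + K x) = x - K x by abel] at h2
  · intro h p hp
    obtain ⟨v, rfl⟩ := mem_graph_perturbed.1 hp
    have h1 := h (shift A lam v)
    rw [hK, iterOp_shift hR, hR.apply_shift] at h1
    rw [hQ.mem_graph_iff, ← sub_sub]
    exact h1

theorem exists_isMinimalSemigroup {A : X →ₗ.[ℝ] X} {B : A.domain →ₗ[ℝ] X}
    {R K G : ℝ → X →L[ℝ] X} (hR : ∀ lam, 0 < lam → IsResolvent A lam (R lam))
    (hK : ∀ lam, 0 < lam → ∀ x, K lam x = iterOp A B lam x) (h : IsKatoSum R K G) :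
    ∃ V : C0Semigroup X, IsMinimalSemigroup A B V ∧
      ∀ lam, 0 < lam → IsResolvent V.generator lam (G lam) := by
  obtain ⟨V, hV, hVG⟩ := h.isSubstochasticResolvent.exists_semigroup
  refine ⟨V, ⟨hV, ?_, fun S hS hAS t u hu => ?_⟩, hVG⟩
  · exact (perturbed_le_iff (hR 1 one_pos) (hK 1 one_pos) (hVG 1 one_pos)).2
      (h.apply_sub one_pos)
  · obtain ⟨Q, hQ, hSQ, -⟩ := hS.exists_resolvent
    exact op_le_op_of_resolvent_le hV hS h.isSubstochasticResolvent hQ hVG hSQ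
      (fun lam hlam u hu => h.sum_le hlam (hQ.nonneg lam hlam)
        ((perturbed_le_iff (hR lam hlam) (hK lam hlam) (hSQ lam hlam)).1 hAS) hu) t hu

theorem IsMinimalSemigroup.unique {A : X →ₗ.[ℝ] X} {B : A.domain →ₗ[ℝ] X} {V W : C0Semigroup X}
    (hV : IsMinimalSemigroup A B V) (hW : IsMinimalSemigroup A B W) : V = W := by
  ext t x
  obtain ⟨a, b, ha, hb, rfl⟩ := AbstractStateSpace.generating x
  have key : ∀ u : X, 0 ≤ u → V.op t u = W.op t u := fun u hu =>
    le_antisymm (hV.minimal W hW.substochastic hW.extends_perturbed t u hu)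
      (hW.minimal V hV.substochastic hV.extends_perturbed t u hu)
  rw [map_sub, map_sub, key a ha, key b hb]

end Generation

/-! ### The defect functional -/

section Defect

variable {X : Type*} [NormedAddCommGroup X] [NormedSpace ℝ X] [CompleteSpace X]
  [PartialOrder X] [IsOrderedAddMonoid X] [IsOrderedModule ℝ X] [OrderClosedTopology X]
  [AbstractStateSpace X]

variable {R K G : ℝ → X →L[ℝ] X} {lam mu : ℝ}

namespace IsKatoPair

theorem antitone_Psi_pow (h : IsKatoPair R K) (hlam : 0 < lam) {u : X} (hu : 0 ≤ u) :
    Antitone fun n => Psi X ((K lam ^ n) u) := by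
  refine antitone_nat_of_succ_le fun n => ?_
  have h1 := h.pow_nonneg hlam hu n
  have h2 := h.pow_nonneg hlam hu (n + 1)
  rw [Psi_of_nonneg _ h1, Psi_of_nonneg _ h2, pow_succ']
  exact (h.substochasticOp hlam _ h1).2

/-- On the cone the sequence `⟨Ψ, Kⁿ u⟩ = ‖Kⁿ u‖` decreases, so it converges; by differences it
converges everywhere, and the limit is continuous by the uniform boundedness principle. -/
theorem exists_defect (h : IsKatoPair R K) (hlam : 0 < lam) :
    ∃ xi : X →L[ℝ] ℝ, ∀ x, Tendsto (fun n => Psi X ((K lam ^ n) x)) atTop (𝓝 (xi x)) := by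
  have hpos : ∀ u : X, 0 ≤ u → ∃ c, Tendsto (fun n => Psi X ((K lam ^ n) u)) atTop (𝓝 c) :=
    fun u hu => ⟨_, tendsto_atTop_ciInf (h.antitone_Psi_pow hlam hu) ⟨0, by
      rintro _ ⟨n, rfl⟩
      have h1 := h.pow_nonneg hlam hu n
      exact (norm_nonneg _).trans_eq (Psi_of_nonneg _ h1).symm⟩⟩
  have hall : ∀ x : X, ∃ c, Tendsto (fun n => Psi X ((K lam ^ n) x)) atTop (𝓝 c) := fun x => by
    obtain ⟨a, b, ha, hb, rfl⟩ := AbstractStateSpace.generating x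
    obtain ⟨c, hc⟩ := hpos a ha
    obtain ⟨d, hd⟩ := hpos b hb
    exact ⟨c - d, (hc.sub hd).congr fun n => by rw [map_sub, map_sub]⟩
  choose f hf using hall
  exact ⟨continuousLinearMapOfTendsto (fun n => (Psi X).comp (K lam ^ n)) (tendsto_pi_nhds.2 hf),
    hf⟩

end IsKatoPair

/-- The mass `⟨Ψ, K ^ n x⟩` that survives all iterations, as a functional of `x`. -/
def IsDefect (K : X →L[ℝ] X) (xi : X →L[ℝ] ℝ) : Prop :=
  ∀ x, Tendsto (fun n => Psi X ((K ^ n) x)) atTop (𝓝 (xi x))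

namespace IsDefect

variable {xi eta : X →L[ℝ] ℝ}

theorem apply_map {P : X →L[ℝ] X} (hxi : IsDefect P xi) (x : X) : xi (P x) = xi x := by
  refine tendsto_nhds_unique (hxi (P x)) (((tendsto_add_atTop_iff_nat 1).2 (hxi x)).congr
    fun n => ?_)
  rw [pow_succ]; rfl

theorem apply_pow {P : X →L[ℝ] X} (hxi : IsDefect P xi) (x : X) (n : ℕ) :
    xi ((P ^ n) x) = xi x := by
  induction n with
  | zero => rfl
  | succ n ih =>
    rw [pow_succ', ← ih]
    exact hxi.apply_map _

theorem le_Psi (h : IsKatoPair R K) (hlam : 0 < lam) (hxi : IsDefect (K lam) xi) {u : X}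
    (hu : 0 ≤ u) : xi u ≤ Psi X u :=
  (h.antitone_Psi_pow hlam hu).le_of_tendsto (hxi u) 0

theorem tendsto_norm (h : IsKatoPair R K) (hlam : 0 < lam) (hxi : IsDefect (K lam) xi) {u : X}
    (hu : 0 ≤ u) : Tendsto (fun n => ‖(K lam ^ n) u‖) atTop (𝓝 (xi u)) :=
  (hxi u).congr fun n => Psi_of_nonneg _ (h.pow_nonneg hlam hu n)

end IsDefect

namespace IsKatoPair

theorem loss_term_nonneg (h : IsKatoPair R K) (hlam : 0 < lam) {u : X} (hu : 0 ≤ u) (n : ℕ) :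
    0 ≤ Psi X ((K lam ^ n) u) - Psi X ((K lam ^ (n + 1)) u) -
      lam * Psi X (R lam ((K lam ^ n) u)) := by
  have h1 := h.loss lam hlam _ (h.resolvent.nonneg lam hlam _ (h.pow_nonneg hlam hu n))
  rw [pow_succ']
  change 0 ≤ _ - Psi X (K lam ((K lam ^ n) u)) - _
  linarith

/-- The loss `𝔞` is monotone on the positive cone of the domain, and `R lam` and `K lam` are
antitone in `lam`, so the terms of the series of losses decrease with `lam`. -/
theorem loss_term_le (h : IsKatoPair R K) (hlam : 0 < lam) (hle : lam ≤ mu) {u : X}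
    (hu : 0 ≤ u) (n : ℕ) :
    Psi X ((K mu ^ n) u) - Psi X ((K mu ^ (n + 1)) u) - mu * Psi X (R mu ((K mu ^ n) u)) ≤
      Psi X ((K lam ^ n) u) - Psi X ((K lam ^ (n + 1)) u) -
        lam * Psi X (R lam ((K lam ^ n) u)) := by
  have hmu := hlam.trans_le hle
  rw [pow_succ', pow_succ']
  change _ - Psi X (K mu ((K mu ^ n) u)) - _ ≤ _ - Psi X (K lam ((K lam ^ n) u)) - _
  have h0 := h.term_le_of_le hlam hle hu n
  set x := (K lam ^ n) u
  set y := (K mu ^ n) u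
  -- the two elements of the domain, expressed through the same parameter `lam`
  have h1 := h.resolvent_shift hlam hmu y
  have h2 := h.apply_shift hlam hmu y
  have h3 := h.loss lam hlam (x - (y + (lam - mu) • R mu y)) (by
    rw [map_sub, h1]; exact sub_nonneg.2 h0)
  rw [map_sub (K lam), map_sub (R lam), h1, h2] at h3
  simp only [map_sub, map_add, map_smul, smul_eq_mul] at h3
  linarith

end IsKatoPair

namespace IsKatoSum

variable {xi eta : X →L[ℝ] ℝ}

/-- The series of losses `𝔞 (R Kⁿ x)` telescopes. -/
theorem hasSum_loss (h : IsKatoSum R K G) (hlam : 0 < lam) (hxi : IsDefect (K lam) xi) (x : X) :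
    HasSum (fun n => Psi X ((K lam ^ n) x) - Psi X ((K lam ^ (n + 1)) x) -
      lam * Psi X (R lam ((K lam ^ n) x))) (Psi X x - xi x - lam * Psi X (G lam x)) := by
  have key : ∀ u : X, 0 ≤ u → HasSum (fun n => Psi X ((K lam ^ n) u) -
      Psi X ((K lam ^ (n + 1)) u) - lam * Psi X (R lam ((K lam ^ n) u)))
      (Psi X u - xi u - lam * Psi X (G lam u)) := fun u hu => by
    rw [hasSum_iff_tendsto_nat_of_nonneg (h.loss_term_nonneg hlam hu)]
    have h1 := (((Psi X).continuous.tendsto _).comp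
      (h.hasSum lam hlam u).tendsto_sum_nat).const_mul lam
    refine (((hxi u).const_sub (Psi X u)).sub h1).congr fun N => ?_
    rw [Finset.sum_sub_distrib, Finset.sum_range_sub', ← Finset.mul_sum, ← map_sum]
    rfl
  obtain ⟨a, b, ha, hb, rfl⟩ := AbstractStateSpace.generating x
  have hval : Psi X (a - b) - xi (a - b) - lam * Psi X (G lam (a - b)) =
      Psi X a - xi a - lam * Psi X (G lam a) - (Psi X b - xi b - lam * Psi X (G lam b)) := by
    simp only [map_sub]
    ring
  rw [hval]
  refine ((key a ha).sub (key b hb)).congr_fun fun n => ?_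
  simp only [map_sub]
  ring

/-- The functionals `xi` and `eta` for two parameters agree, up to the change of parameter. -/
theorem defect_shift_of_le (h : IsKatoSum R K G) (hlam : 0 < lam) (hle : lam ≤ mu)
    (hxi : IsDefect (K lam) xi) (heta : IsDefect (K mu) eta) (x : X) :
    eta (x + (mu - lam) • G lam x) = xi x := by
  have hmu := hlam.trans_le hle
  -- the left-hand side is invariant under `K lam`
  have hinv : ∀ x, eta (K lam x + (mu - lam) • G lam (K lam x)) =
      eta (x + (mu - lam) • G lam x) := fun x => by
    have h1 := heta.apply_map (x + (mu - lam) • R lam x)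
    rw [h.apply_shift hmu hlam] at h1
    have h2 := h.apply_sub hlam x
    rw [map_sub] at h2
    rw [map_add eta, h1, ← map_add, ← h2]
    congr 1
    module
  have hpow : ∀ x (n : ℕ), eta ((K lam ^ n) x + (mu - lam) • G lam ((K lam ^ n) x)) =
      eta (x + (mu - lam) • G lam x) := fun x n => by
    induction n with
    | zero => rfl
    | succ n ih =>
      rw [pow_succ', ← ih]
      exact hinv _
  have key : ∀ u : X, 0 ≤ u → eta (u + (mu - lam) • G lam u) = xi u := fun u hu => by
    have hG := h.tendsto_apply_pow_self hlam u
    have hlim : Tendsto (fun n => eta ((K lam ^ n) u)) atTop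
        (𝓝 (eta (u + (mu - lam) • G lam u))) := by
      have h1 := (((eta.continuous.tendsto 0).comp hG).const_mul (mu - lam)).const_sub
        (eta (u + (mu - lam) • G lam u))
      rw [map_zero, mul_zero, sub_zero] at h1
      refine h1.congr fun n => ?_
      rw [← hpow u n, map_add, map_smul, smul_eq_mul]
      exact add_sub_cancel_right _ _
    refine le_antisymm ?_ ?_
    · exact le_of_tendsto_of_tendsto' hlim (hxi u) fun n =>
        IsDefect.le_Psi h.toIsKatoPair hmu heta (h.pow_nonneg hlam hu n)
    -- the comparison of the losses along the iteration that starts from `K lam ^ n u`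
    · have h1 := hlim.add (((Psi X).continuous.tendsto 0).comp hG |>.const_mul mu)
      rw [map_zero, mul_zero, add_zero] at h1
      refine ge_of_tendsto' h1 fun n => ?_
      have hn := h.pow_nonneg hlam hu n
      have h2 := hasSum_le (h.loss_term_le hlam hle hn) (h.hasSum_loss hmu heta _)
        (h.hasSum_loss hlam hxi _)
      rw [hxi.apply_pow] at h2
      have h3 := h.apply_le_of_le hlam hle hn
      have h4 := h.sum_nonneg hmu hn
      have h5 := h.sum_nonneg hlam hn
      have h6 : mu * Psi X (G mu ((K lam ^ n) u)) ≤ mu * Psi X (G lam ((K lam ^ n) u)) := by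
        rw [Psi_of_nonneg _ h4, Psi_of_nonneg _ h5]
        exact mul_le_mul_of_nonneg_left (norm_le_norm_of_nonneg_of_le h4 h3) hmu.le
      have h7 : 0 ≤ lam * Psi X (G lam ((K lam ^ n) u)) := by
        rw [Psi_of_nonneg _ h5]
        positivity
      change xi u ≤ eta ((K lam ^ n) u) + mu * Psi X (G lam ((K lam ^ n) u))
      linarith
  obtain ⟨a, b, ha, hb, rfl⟩ := AbstractStateSpace.generating x
  rw [map_sub xi, ← key a ha, ← key b hb, ← map_sub eta, map_sub (G lam)]
  congr 1
  module

/-- The sum of the losses along the iteration does not depend on the parameter. -/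
theorem total_loss_eq (h : IsKatoSum R K G) (hlam : 0 < lam) (hmu : 0 < mu)
    (hxi : IsDefect (K lam) xi) (heta : IsDefect (K mu) eta) {x y : X}
    (hxy : G lam x = G mu y) (hsub : x - y = (lam - mu) • G lam x) :
    Psi X x - xi x - lam * Psi X (G lam x) = Psi X y - eta y - mu * Psi X (G mu y) := by
  wlog hle : lam ≤ mu generalizing lam mu xi eta x y
  · refine (this hmu hlam heta hxi hxy.symm ?_ (le_of_not_ge hle)).symm
    rw [← hxy, ← neg_sub x y, hsub, ← neg_smul, neg_sub]
  have hy : y = x + (mu - lam) • G lam x := by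
    linear_combination (norm := module) -hsub
  rw [← hxy, ← h.defect_shift_of_le hlam hle hxi heta x, ← hy]
  have h1 : Psi X y = Psi X x + (mu - lam) * Psi X (G lam x) := by
    rw [hy, map_add, map_smul, smul_eq_mul]
  rw [h1]
  ring

end IsKatoSum

end Defect

/-! ### Honesty of the minimal semigroup -/

section WeakCompactness

variable {X : Type*} [NormedAddCommGroup X] [NormedSpace ℝ X] [CompleteSpace X]
  [PartialOrder X] [IsOrderedAddMonoid X] [IsOrderedModule ℝ X] [OrderClosedTopology X]
  [AbstractStateSpace X]

theorem isRelativelyWeaklyCompact_of_tendsto {f : ℕ → X} {x : X}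
    (hf : Tendsto f atTop (𝓝 x)) : IsRelativelyWeaklyCompact (Set.range f) := by
  have h1 : IsCompact (toWeakSpace ℝ X '' insert x (Set.range f)) :=
    hf.isCompact_insert_range.image (toWeakSpaceCLM ℝ X).continuous
  exact h1.closure_of_subset (Set.image_mono (Set.subset_insert _ _))

/-- A weak cluster point `z` of the iterates satisfies `R z = 0`, because the terms of the
convergent series `∑ R (K ^ n u)` tend to zero; hence `z = 0`, and the limit of `⟨Ψ, K ^ n u⟩`
is `⟨Ψ, z⟩ = 0`. -/
theorem IsKatoSum.defect_eq_zero_of_isRelativelyWeaklyCompact {R K G : ℝ → X →L[ℝ] X} {lam : ℝ}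
    {xi : X →L[ℝ] ℝ} (h : IsKatoSum R K G) (hlam : 0 < lam) (hxi : IsDefect (K lam) xi)
    (hinj : Function.Injective (R lam)) {u : X}
    (hu : IsRelativelyWeaklyCompact (Set.range fun n : ℕ => (K lam ^ n) u)) : xi u = 0 := by
  obtain ⟨z, -, hz⟩ := hu.exists_mapClusterPt (f := atTop)
    (u := fun n : ℕ => toWeakSpace ℝ X ((K lam ^ n) u))
    (tendsto_principal.2 (Eventually.of_forall fun n =>
      subset_closure (Set.mem_image_of_mem _ (Set.mem_range_self n))))
  obtain ⟨w, rfl⟩ := (toWeakSpace ℝ X).surjective z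
  have hfun : ∀ (f : X →L[ℝ] ℝ) (c : ℝ),
      Tendsto (fun n => f ((K lam ^ n) u)) atTop (𝓝 c) → f w = c := fun f c hc => by
    have hcont : Continuous fun y : WeakSpace ℝ X => f ((toWeakSpace ℝ X).symm y) :=
      WeakBilin.eval_continuous _ f
    have h1 := hz.tendsto_comp (hcont.tendsto (toWeakSpace ℝ X w))
    have h2 : MapClusterPt (f w) atTop fun n => f ((K lam ^ n) u) := h1
    have h3 : ClusterPt (f w) (𝓝 c) := h2.clusterPt.mono hc
    exact eq_of_nhds_neBot h3
  have hw : w = 0 := by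
    apply hinj
    rw [map_zero]
    refine SeparatingDual.eq_zero_of_forall_dual_eq_zero (R := ℝ) fun g => ?_
    refine hfun (g.comp (R lam)) 0 ?_
    have h1 := (g.continuous.tendsto 0).comp (h.hasSum lam hlam u).summable.tendsto_atTop_zero
    rwa [map_zero] at h1
  rw [← hfun (Psi X) (xi u) (hxi u), hw, map_zero]

end WeakCompactness

end Honesty

open Honesty in
theorem theorem3p4 {X : Type*} [NormedAddCommGroup X] [NormedSpace ℝ X] [CompleteSpace X]
    [PartialOrder X] [IsOrderedAddMonoid X] [IsOrderedModule ℝ X] [OrderClosedTopology X]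
    [AbstractStateSpace X]
    (U : C0Semigroup X) (hU : U.IsSubstochastic)
    (B : U.generator.domain →ₗ[ℝ] X)
    (hB : ∀ u : U.generator.domain, 0 ≤ (u : X) → 0 ≤ B u)
    (hAB : ∀ u : U.generator.domain, 0 ≤ (u : X) → Psi X (U.generator u + B u) ≤ 0) :
    -- the minimal semigroup exists and is unique
    (∃! V : C0Semigroup X, IsMinimalSemigroup U.generator B V) ∧
    ∀ V : C0Semigroup X, IsMinimalSemigroup U.generator B V →
      -- the objects in the equivalences are well defined
      (perturbed U.generator B).IsClosable ∧
      (∀ lam : ℝ, 0 < lam →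
        lam ∈ realResolventSet U.generator ∧ lam ∈ realResolventSet V.generator ∧
        (∀ u : X, Summable (abarTerm U.generator B lam u)) ∧
        ∃ xi : X →L[ℝ] ℝ, ∀ u : X, xi u = Xi U.generator B V.generator lam u) ∧
      (∀ lam mu : ℝ, 0 < lam → 0 < mu → ∀ v : V.generator.domain,
        abar U.generator B V.generator lam v = abar U.generator B V.generator mu v) ∧
      -- the equivalences for a fixed parameter and a fixed positive element
      (∀ lam : ℝ, 0 < lam → ∀ u : X, 0 ≤ u →
        List.TFAE [
          IsRelativelyWeaklyCompact (Set.range fun n : ℕ => (iterOp U.generator B lam ^ n) u),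
          Tendsto (fun n : ℕ => ‖(iterOp U.generator B lam ^ n) u‖) atTop (𝓝 0),
          Xi U.generator B V.generator lam u = 0,
          (invShift V.generator lam u : X) ∈ (perturbed U.generator B).closure.domain]) ∧
      -- the corollary
      List.TFAE [
        V.generator = (perturbed U.generator B).closure,
        ∃ lam : ℝ, 0 < lam ∧ ∀ u : X, Xi U.generator B V.generator lam u = 0,
        ∀ lam : ℝ, 0 < lam → ∀ u : X, Xi U.generator B V.generator lam u = 0] := by
  obtain ⟨R, hRs, hR, -⟩ := hU.exists_resolvent
  obtain ⟨K, hK, hRK⟩ := exists_isKatoPair hRs hR hB hAB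
  obtain ⟨G, hG⟩ := hRK.exists_sum
  have h : IsKatoSum R K G := ⟨hRK, hG⟩
  obtain ⟨V₀, hV₀, hVG⟩ := exists_isMinimalSemigroup hR hK h
  refine ⟨⟨V₀, hV₀, fun W hW => hW.unique hV₀⟩, fun V hV => ?_⟩
  obtain rfl := hV.unique hV₀
  have hiter : ∀ lam, 0 < lam → ∀ (n : ℕ) x,
      (iterOp U.generator B lam ^ n) x = (K lam ^ n) x := by
    intro lam hlam n x
    induction n with
    | zero => rfl
    | succ n ih =>
      rw [pow_succ', pow_succ', Module.End.mul_apply, ih, ← hK lam hlam]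
      rfl
  -- the functional `Ξ`; its values for `lam ≤ 0` play no role
  have hdefect : ∀ lam : ℝ, ∃ xi : X →L[ℝ] ℝ, 0 < lam → IsDefect (K lam) xi := fun lam => by
    by_cases hlam : 0 < lam
    · obtain ⟨xi, hxi⟩ := hRK.exists_defect hlam
      exact ⟨xi, fun _ => hxi⟩
    · exact ⟨0, fun h => absurd h hlam⟩
  choose xi hxi using hdefect
  have hterm : ∀ lam, 0 < lam → ∀ x n, abarTerm U.generator B lam x n =
      Psi X ((K lam ^ n) x) - Psi X ((K lam ^ (n + 1)) x) -
        lam * Psi X (R lam ((K lam ^ n) x)) := by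
    intro lam hlam x n
    have h1 : perturbed U.generator B (invShift U.generator lam ((iterOp U.generator B lam ^ n) x))
        = lam • R lam ((K lam ^ n) x) - (K lam ^ n) x + (K lam ^ (n + 1)) x := by
      rw [hiter lam hlam, (hR lam hlam).invShift_eq, pow_succ']
      change U.generator ⟨R lam ((K lam ^ n) x), _⟩ + B ⟨R lam ((K lam ^ n) x), _⟩ =
        _ + K lam ((K lam ^ n) x)
      rw [(hR lam hlam).map_apply, hK lam hlam, iterOp_apply (hR lam hlam)]
    change -Psi X (perturbed U.generator B
      (invShift U.generator lam ((iterOp U.generator B lam ^ n) x))) = _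
    rw [h1]
    simp only [map_add, map_sub, map_smul, smul_eq_mul]
    ring
  have hsum : ∀ lam, 0 < lam → ∀ x, HasSum (abarTerm U.generator B lam x)
      (Psi X x - xi lam x - lam * Psi X (G lam x)) := fun lam hlam x =>
    (h.hasSum_loss hlam (hxi lam hlam) x).congr_fun fun n => hterm lam hlam x n
  have hXi : ∀ lam, 0 < lam → ∀ x, xi lam x = Xi U.generator B V.generator lam x := by
    intro lam hlam x
    change _ = -Psi X (V.generator (invShift V.generator lam x)) -
      ∑' n, abarTerm U.generator B lam (shift V.generator lam (invShift V.generator lam x)) n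
    rw [(hVG lam hlam).invShift_eq, (hVG lam hlam).map_apply,
      (hVG lam hlam).shift_apply, (hsum lam hlam x).tsum_eq, map_sub, map_smul, smul_eq_mul]
    ring
  have hle := hV.extends_perturbed
  have hclosed := (hVG 1 one_pos).isClosed
  have hclosable : (perturbed U.generator B).IsClosable := hclosed.isClosable.leIsClosable hle
  have hcle : (perturbed U.generator B).closure ≤ V.generator := by
    have h1 := hclosed.isClosable.closure_mono hle
    have h2 : V.generator.closure = V.generator := by
      apply LinearPMap.eq_of_eq_graph
      rw [← hclosed.isClosable.graph_closure_eq_closure_graph]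
      exact hclosed.submodule_topologicalClosure_eq
    rwa [h2] at h1
  have htfae : ∀ lam : ℝ, 0 < lam → ∀ u : X, 0 ≤ u →
      List.TFAE [
        IsRelativelyWeaklyCompact (Set.range fun n : ℕ => (iterOp U.generator B lam ^ n) u),
        Tendsto (fun n : ℕ => ‖(iterOp U.generator B lam ^ n) u‖) atTop (𝓝 0),
        Xi U.generator B V.generator lam u = 0,
        (invShift V.generator lam u : X) ∈ (perturbed U.generator B).closure.domain] := by
    intro lam hlam u hu
    simp only [hiter lam hlam]
    rw [← hXi lam hlam, (hVG lam hlam).coe_invShift]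
    tfae_have 1 → 3 := fun h1 =>
      h.defect_eq_zero_of_isRelativelyWeaklyCompact hlam (hxi lam hlam) (hR lam hlam).injective h1
    tfae_have 3 → 2 := fun h3 => by
      have := IsDefect.tendsto_norm hRK hlam (hxi lam hlam) hu
      rwa [h3] at this
    tfae_have 2 → 1 := fun h2 =>
      isRelativelyWeaklyCompact_of_tendsto (tendsto_zero_iff_norm_tendsto_zero.2 h2)
    tfae_have 2 → 4 := fun h2 => by
      refine LinearPMap.mem_domain_of_mem_graph (y := lam • G lam u - u) ?_
      rw [← hclosable.graph_closure_eq_closure_graph]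
      have h3 := (h.hasSum lam hlam u).tendsto_sum_nat
      have h4 := ((h3.const_smul lam).sub_const u).add (tendsto_zero_iff_norm_tendsto_zero.2 h2)
      rw [add_zero] at h4
      refine mem_closure_of_tendsto (h3.prodMk_nhds h4) (Eventually.of_forall fun N => ?_)
      -- the partial sums of `G u` lie in the domain of `A + B`
      have hmem : (R lam (∑ n ∈ Finset.range N, (K lam ^ n) u),
          lam • R lam (∑ n ∈ Finset.range N, (K lam ^ n) u) - u + (K lam ^ N) u) ∈
          (perturbed U.generator B).graph := by
        refine mem_graph_perturbed.2 ⟨⟨_, (hR lam hlam).mem_domain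
          (∑ n ∈ Finset.range N, (K lam ^ n) u)⟩, Prod.ext rfl ?_⟩
        rw [(hR lam hlam).map_apply, ← iterOp_apply (hR lam hlam), ← hK lam hlam]
        linear_combination (norm := module) sum_pow_apply_sub_map (K lam) u N
      rw [map_sum (R lam)] at hmem
      exact hmem
    tfae_have 4 → 3 := fun h4 => by
      obtain ⟨y, hy⟩ := LinearPMap.mem_domain_iff.1 h4
      have hyG := LinearPMap.le_graph_of_le hcle hy
      have h5 := (hVG lam hlam).left_inv _ _ hyG
      have h6 : lam • G lam u - y = u := (hVG lam hlam).injective h5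
      rw [← hclosable.graph_closure_eq_closure_graph] at hy
      have h7 : IsClosed {p : X × X | xi lam (lam • p.1 - p.2) = 0} :=
        isClosed_eq (by fun_prop) continuous_const
      -- `Ξ` vanishes on the range of `lam - A - B`, because `Ξ ∘ K = Ξ`
      have h8 : ((perturbed U.generator B).graph : Set (X × X)) ⊆
          {p : X × X | xi lam (lam • p.1 - p.2) = 0} := fun p hp => by
        obtain ⟨v, rfl⟩ := mem_graph_perturbed.1 hp
        have h9 := (hxi lam hlam).apply_map (shift U.generator lam v)
        rw [hK lam hlam, iterOp_shift (hR lam hlam)] at h9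
        change xi lam (lam • (v : X) - (U.generator v + B v)) = 0
        rw [← sub_sub, map_sub, h9]
        exact sub_self _
      have h10 : xi lam (lam • G lam u - y) = 0 := closure_minimal h8 h7 hy
      rwa [h6] at h10
    tfae_finish
  refine ⟨hclosable, fun lam hlam => ⟨(hR lam hlam).mem_realResolventSet,
    (hVG lam hlam).mem_realResolventSet, fun u => (hsum lam hlam u).summable, xi lam,
    hXi lam hlam⟩, ?_, htfae, ?_⟩
  · intro lam mu hlam hmu v
    rw [abar, abar, (hsum lam hlam _).tsum_eq, (hsum mu hmu _).tsum_eq]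
    refine h.total_loss_eq hlam hmu (hxi lam hlam) (hxi mu hmu) ?_ ?_
    · rw [(hVG lam hlam).apply_shift, (hVG mu hmu).apply_shift]
    · rw [(hVG lam hlam).apply_shift, sub_smul]
      exact sub_sub_sub_cancel_right _ _ _
  · tfae_have 1 → 3 := fun h1 lam hlam x => by
      have hpos : ∀ u : X, 0 ≤ u → xi lam u = 0 := fun u hu => by
        rw [hXi lam hlam]
        refine ((htfae lam hlam u hu).out 2 3).2 ?_
        rw [← h1]
        exact (invShift V.generator lam u).2
      obtain ⟨a, b, ha, hb, rfl⟩ := AbstractStateSpace.generating x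
      rw [← hXi lam hlam, map_sub, hpos a ha, hpos b hb, sub_zero]
    tfae_have 3 → 2 := fun h3 => ⟨1, one_pos, h3 1 one_pos⟩
    tfae_have 2 → 1 := by
      rintro ⟨lam, hlam, h2⟩
      refine (LinearPMap.eq_of_le_of_domain_eq hcle (le_antisymm hcle.1 fun v hv => ?_)).symm
      obtain ⟨w, rfl⟩ : ∃ w : V.generator.domain, (w : X) = v := ⟨⟨v, hv⟩, rfl⟩
      rw [← (hVG lam hlam).apply_shift w, ← (hVG lam hlam).coe_invShift]
      obtain ⟨a, b, ha, hb, hab⟩ :=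
        AbstractStateSpace.generating (shift V.generator lam w)
      rw [hab, map_sub]
      exact Submodule.sub_mem _ (((htfae lam hlam a ha).out 2 3).1 (h2 a))
        (((htfae lam hlam b hb).out 2 3).1 (h2 b))
    tfae_finish
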